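/- Let $n\ge 2$, let $\mathbb S^n\subset\mathbb R^{n+1}$ be the unit sphere with its canonical metric $\overline g$, and let $U\subseteq\mathbb S^n$ be an open subset. An equator is the intersection of $\mathbb S^n$ with a hyperplane of $\mathbb R^{n+1}$ through the origin. For a smooth positive definite symmetric two-tensor $h$ on $U$ let $dV_h$ denote its Riemannian volume element. A smooth symmetric two-tensor $k$ on $U$ is a Killing tensor of $(U,\overline g)$ if the cyclic symmetrisation of $\overline\nabla k$ vanishes on $U$, where $\overline\nabla$ is the Levi-Civita connection of $\overline g$ (equivalently, $k(\gamma',\gamma')$ is constant along every geodesic $\gamma$ of $(U,\overline g)$). For every Riemannian metric $g$ on $U$ there is a unique positive smooth function $F_g$ on $U$ with $dV_g=F_g^{(n+1)/4}\,dV_{\overline g}$, and for every smooth positive definite symmetric two-tensor $k$ on $U$ there is a unique positive smooth function $D_k$ on $U$ with $dV_k=D_k^{(n-1)/4}\,dV_{\overline g}$. Moreover: (i) If $g$ is a Riemannian metric on $U$ such that the intersections of all equators with $U$ are minimal hypersurfaces of $(U,g)$ (that is, have zero mean curvature), then $k_g:=\frac1{F_g}\,g$ is a positive definite Killing symmetric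 two-tensor of $(U,\overline g)$. (ii) If $k$ is a positive definite Killing symmetric two-tensor of $(U,\overline g)$, then $g_k:=\frac1{D_k}\,k$ is a Riemannian metric on $U$ such that the intersections of all equators with $U$ are minimal hypersurfaces of $(U,g_k)$. (iii) The maps $g\mapsto k_g$ and $k\mapsto g_k$, between the set of Riemannian metrics on $U$ as in (i) and the set of positive definite Killing symmetric two-tensors of $(U,\overline g)$, are inverse to each other. -/

import Mathlib

open scoped Manifold ContDiff Topology InnerProductSpace
open Bundle TopologicalSpace

noncomputable section

namespace MinimalEquators

/-- The unit sphere `S^n` in `ℝ^{n+1}`, with its smooth structure from Mathlib. -/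
abbrev Sph (n : ℕ) : Type := Metric.sphere (0 : EuclideanSpace ℝ (Fin (n + 1))) 1

/-- Vector fields on `U` (no regularity imposed). -/
abbrev VField {n : ℕ} (U : Opens (Sph n)) : Type :=
  (x : U) → TangentSpace (𝓡 n) x

/-- Covariant two-tensor fields on `U` (no regularity imposed). -/
abbrev Tensor2 {n : ℕ} (U : Opens (Sph n)) : Type :=
  (x : U) → TangentSpace (𝓡 n) x →L[ℝ] TangentSpace (𝓡 n) x →L[ℝ] ℝ

/-- Smooth positive definite symmetric two-tensor fields on `U`, i.e. (smooth) Riemannian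
metrics on `U`. -/
abbrev PosTensor {n : ℕ} (U : Opens (Sph n)) : Type :=
  ContMDiffRiemannianMetric (𝓡 n) ∞ (EuclideanSpace ℝ (Fin n))
    (fun x : U ↦ TangentSpace (𝓡 n) x)

/-- The inclusion of `U ⊆ S^n` in `ℝ^{n+1}`. -/
def incl {n : ℕ} (U : Opens (Sph n)) (x : U) : EuclideanSpace ℝ (Fin (n + 1)) :=
  ((x : Sph n) : EuclideanSpace ℝ (Fin (n + 1)))

/-- The canonical metric of `S^n` on `U`: the Euclidean inner product of `ℝ^{n+1}` pulled back by
the inclusion. -/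
def roundMetric {n : ℕ} (U : Opens (Sph n)) : Tensor2 U := fun x ↦
  (ContinuousLinearMap.precomp ℝ (mvfderiv (𝓡 n) (incl U) x)).comp
    ((innerSL ℝ (E := EuclideanSpace ℝ (Fin (n + 1)))).comp (mvfderiv (𝓡 n) (incl U) x))

theorem roundMetric_apply {n : ℕ} (U : Opens (Sph n)) (x : U) (X Y : TangentSpace (𝓡 n) x) :
    roundMetric U x X Y =
      ⟪mvfderiv (𝓡 n) (incl U) x X, mvfderiv (𝓡 n) (incl U) x Y⟫_ℝ :=
  rfl

/-- The vector field `X` is differentiable at `x`. -/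
def DiffAt {n : ℕ} {U : Opens (Sph n)} (X : VField U) (x : U) : Prop :=
  MDifferentiableAt (𝓡 n) ((𝓡 n).prod 𝓘(ℝ, EuclideanSpace ℝ (Fin n)))
    (fun y : U ↦ TotalSpace.mk' (EuclideanSpace ℝ (Fin n)) (E := fun x : U ↦ TangentSpace (𝓡 n) x)
      y (X y)) x

/-- The vector field `X` is smooth near `x`. -/
def SmoothAt {n : ℕ} {U : Opens (Sph n)} (X : VField U) (x : U) : Prop :=
  ContMDiffAt (𝓡 n) ((𝓡 n).prod 𝓘(ℝ, EuclideanSpace ℝ (Fin n))) ∞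
    (fun y : U ↦ TotalSpace.mk' (EuclideanSpace ℝ (Fin n)) (E := fun x : U ↦ TangentSpace (𝓡 n) x)
      y (X y)) x

/-- The connection `∇` (with `cov Y x (X x)` standing for `(∇_X Y)(x)`) is a Levi-Civita connection
of `g`: it is torsion free and `X (g(Y, Z)) = g(∇_X Y, Z) + g(Y, ∇_X Z)`. -/
def IsLeviCivita {n : ℕ} {U : Opens (Sph n)} (g : Tensor2 U)
    (cov : CovariantDerivative (𝓡 n) (EuclideanSpace ℝ (Fin n))
      (fun x : U ↦ TangentSpace (𝓡 n) x)) : Prop :=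
  cov.torsion = 0 ∧
  ∀ (x : U) (X Y Z : VField U),
    DiffAt X x → DiffAt Y x → DiffAt Z x →
      mvfderiv (𝓡 n) (fun y ↦ g y (Y y) (Z y)) x (X x) =
        g x (cov Y x (X x)) (Z x) + g x (Y x) (cov Z x (X x))

/-- `(∇k)(X, Y, Z) = Z (k(X, Y)) - k(∇_Z X, Y) - k(X, ∇_Z Y)` at the point `x`. -/
def covDerivTensor {n : ℕ} {U : Opens (Sph n)}
    (cov : CovariantDerivative (𝓡 n) (EuclideanSpace ℝ (Fin n))
      (fun x : U ↦ TangentSpace (𝓡 n) x))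
    (k : Tensor2 U) (X Y Z : VField U) (x : U) : ℝ :=
  mvfderiv (𝓡 n) (fun y ↦ k y (X y) (Y y)) x (Z x)
    - k x (cov X x (Z x)) (Y x) - k x (X x) (cov Y x (Z x))

/-- `k` is a Killing tensor of the metric `g`: the cyclic symmetrisation of `∇k` vanishes, for the
Levi-Civita connection `∇` of `g`. (Applied below to smooth symmetric `k` only.) -/
def IsKillingTensor {n : ℕ} {U : Opens (Sph n)} (g k : Tensor2 U) : Prop :=
  ∃ cov : CovariantDerivative (𝓡 n) (EuclideanSpace ℝ (Fin n))
      (fun x : U ↦ TangentSpace (𝓡 n) x),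
    IsLeviCivita g cov ∧
    ∀ (x : U) (X Y Z : VField U),
      DiffAt X x → DiffAt Y x → DiffAt Z x →
        covDerivTensor cov k X Y Z x + covDerivTensor cov k Y Z X x
          + covDerivTensor cov k Z X Y x = 0

/-- The function `x ↦ ⟨x, v⟩` on `U`. For `v ≠ 0`, `0` is a regular value, and its zero set is
the intersection with `U` of the equator orthogonal to `v`. -/
def height {n : ℕ} (U : Opens (Sph n)) (v : EuclideanSpace ℝ (Fin (n + 1))) (x : U) : ℝ :=
  ⟪incl U x, v⟫_ℝ

/-- The hypersurface `Σ = {f = 0}` of `U` (`0` being a regular value of `f`, so that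
`T_pΣ = ker df_p`) is minimal with respect to the metric `g`: at every `p ∈ Σ` its mean curvature
vector `∑ i, (∇_{E_i} E_i)^⊥` vanishes. Here `E_1, …, E_{n-1}` are local smooth vector fields
that are tangent to `Σ` along `Σ` and `g`-orthonormal at `p`, `∇` is the Levi-Civita connection of
`g`, and the normal component is tested against the vectors `ν` that are `g`-normal to `T_pΣ`. -/
def IsMinimalZeroSet {n : ℕ} {U : Opens (Sph n)} (g : Tensor2 U) (f : U → ℝ) : Prop :=
  ∃ cov : CovariantDerivative (𝓡 n) (EuclideanSpace ℝ (Fin n))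
      (fun x : U ↦ TangentSpace (𝓡 n) x),
    IsLeviCivita g cov ∧
    ∀ p : U, f p = 0 →
      ∀ E : Fin (n - 1) → VField U,
        (∀ i, SmoothAt (E i) p) →
        (∀ i, ∀ᶠ q in 𝓝 p, f q = 0 → mvfderiv (𝓡 n) f q (E i q) = 0) →
        (∀ i j, g p (E i p) (E j p) = if i = j then 1 else 0) →
        ∀ ν : TangentSpace (𝓡 n) p,
          (∀ w : TangentSpace (𝓡 n) p, mvfderiv (𝓡 n) f p w = 0 → g p ν w = 0) →
            ∑ i, g p (cov (E i) p (E i p)) ν = 0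

/-- The intersections of all equators with `U` are minimal hypersurfaces of `(U, g)`. -/
def HasMinimalEquators {n : ℕ} {U : Opens (Sph n)} (g : Tensor2 U) : Prop :=
  ∀ v : EuclideanSpace ℝ (Fin (n + 1)), v ≠ 0 → IsMinimalZeroSet g (height U v)

/-- The volume element `dV_g` of `g`: the volume `√ det (g(v_i, v_j))` of the parallelepiped spanned
by the tangent vectors `v_1, …, v_n` at `x`. -/
def volElement {n : ℕ} {U : Opens (Sph n)} (g : Tensor2 U) (x : U)
    (v : Fin n → TangentSpace (𝓡 n) x) : ℝ :=
  √(Matrix.of fun i j ↦ g x (v i) (v j)).det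

/-- `F` is a positive smooth function on `U` with `dV_g = F^r dV`, where `dV` is the volume element
of the canonical metric. -/
def IsVolumeFactor {n : ℕ} {U : Opens (Sph n)} (r : ℝ) (g : Tensor2 U) (F : U → ℝ) : Prop :=
  (∀ x, 0 < F x) ∧ ContMDiff (𝓡 n) 𝓘(ℝ) ∞ F ∧
  ∀ (x : U) (v : Fin n → TangentSpace (𝓡 n) x),
    volElement g x v = F x ^ r * volElement (roundMetric U) x v

/-- The Riemannian metrics on `U` for which all equators are minimal. -/
def MinimalEquatorMetric {n : ℕ} (U : Opens (Sph n)) : Type :=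
  {g : PosTensor U // HasMinimalEquators g.inner}

/-- The positive definite Killing symmetric two-tensors of `U` with the canonical metric. -/
def PosKillingTensor {n : ℕ} (U : Opens (Sph n)) : Type :=
  {k : PosTensor U // IsKillingTensor (roundMetric U) k.inner}

end MinimalEquators

end

noncomputable section

namespace MinimalEquators

/-! Compare the Levi-Civita connection of `g` with the round one. Let `D = ∇̄g` be the covariant
derivative for the round connection `∇̄` (`covTensor`). The Koszul formula expresses `∇ - ∇̄`
through `D`. Equators are totally geodesic for `∇̄`, so twice the mean curvature of an equator in
the normal direction `x` is the `g`-trace over `x^⊥` of `2 D(e, e, x) - D(x, e, e)` (`curvForm`).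
Every tangent hyperplane is tangent to an equator, so minimality of all equators is a pointwise
algebraic condition on `D` (`hasMinimalEquators_iff`).

The trace over the whole tangent space exceeds the trace over `x^⊥` by `D(x, x, x) / g(x, x)`. Hence
minimality forces `D(x, x, x) = θ(x) g(x, x)`, where the linear form `θ` is the full trace.
Polarising this cubic identity and tracing it gives `tr_g D(x, ·, ·) = (n + 1)/2 · θ(x)`. By
Jacobi's formula that trace is the logarithmic derivative of `det g` relative to the round metric,
which is `(n + 1)/2 · d log F_g`. Thus `θ = d log F_g`, and the condition says that `∇̄(g / F_g)`
vanishes on the diagonal; by polarisation this is the Killing equation.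

The argument reverses (`diag_eq_of_sum_curvForm_eq_zero`, `sum_curvForm_eq_zero`). The two maps are
inverse because dividing by the factor with exponent `r` inverts that factor and replaces `2r` by `n
- 2r`, which exchanges `(n + 1)/4` and `(n - 1)/4`. -/

section

/-! ### Vector fields on a manifold seen through a map into a vector space -/

section Immersion

variable {E : Type*} [NormedAddCommGroup E] [NormedSpace ℝ E]
  {H : Type*} [TopologicalSpace H] {I : ModelWithCorners ℝ E H}
  {M : Type*} [TopologicalSpace M] [ChartedSpace H M]
  {F : Type*} [NormedAddCommGroup F] [NormedSpace ℝ F]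

variable (I) in
/-- The differential of `f`, read in the trivialization of the tangent bundle at `p`. -/
def coordDeriv [IsManifold I 1 M] (f : M → F) (p : M) : M → E →L[ℝ] F :=
  inTangentCoordinates I 𝓘(ℝ, F) id f (mfderiv I 𝓘(ℝ, F) f) p

theorem coordDeriv_apply [IsManifold I 1 M] (f : M → F) (p : M) {y : M}
    (hy : y ∈ (chartAt H p).source) (v : E) :
    coordDeriv I f p y v = mvfderiv I f y
      ((tangentBundleCore I M).coordChange (achart H p) (achart H y) y v) := by
  have h := inTangentCoordinates_eq (I := I) (I' := 𝓘(ℝ, F)) (id : M → M) f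
    (mfderiv I 𝓘(ℝ, F) f) (x₀ := p) (x := y) hy (mem_chart_source F (f p))
  rw [tangentBundleCore_coordChange_model_space] at h
  exact congr($h v)

theorem coordDeriv_self_apply [IsManifold I 1 M] (f : M → F) (p : M) (v : E) :
    coordDeriv I f p p v = mvfderiv I f p v := by
  refine (coordDeriv_apply f p (mem_chart_source H p) v).trans ?_
  exact congrArg _ ((tangentBundleCore I M).coordChange_self (achart H p) p
    (mem_chart_source H p) v)

theorem coordDeriv_trivializationAt [IsManifold I 1 M] (f : M → F) (p : M) {y : M}
    (hy : y ∈ (chartAt H p).source) (v : TangentSpace I y) :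
    coordDeriv I f p y (trivializationAt E (TangentSpace I) p ⟨y, v⟩).2 = mvfderiv I f y v := by
  rw [coordDeriv_apply f p hy]
  congr 1
  refine ((tangentBundleCore I M).coordChange_comp (achart H y) (achart H p) (achart H y) y
    ⟨⟨mem_chart_source H y, hy⟩, mem_chart_source H y⟩ v).trans ?_
  exact (tangentBundleCore I M).coordChange_self (achart H y) y (mem_chart_source H y) v

theorem contMDiffAt_coordDeriv [IsManifold I ∞ M] [IsManifold I 1 M] {f : M → F} {p : M}
    (hf : ContMDiffAt I 𝓘(ℝ, F) ∞ f p) :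
    ContMDiffAt I 𝓘(ℝ, E →L[ℝ] F) ∞ (coordDeriv I f p) p :=
  hf.mfderiv_const (by simp)

theorem mdifferentiableAt_mvfderiv_apply [IsManifold I ∞ M] {f : M → F} {p : M}
    (hf : ContMDiffAt I 𝓘(ℝ, F) ∞ f p) {X : Π y : M, TangentSpace I y}
    (hX : MDifferentiableAt I (I.prod 𝓘(ℝ, E)) (fun y ↦ TotalSpace.mk' E y (X y)) p) :
    MDifferentiableAt I 𝓘(ℝ, F) (fun y ↦ mvfderiv I f y (X y)) p := by
  have : IsManifold I 1 M := .of_le (n := ∞) (by simp)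
  have h1 := (contMDiffAt_coordDeriv hf).mdifferentiableAt (by simp)
  have h2 := (mdifferentiableAt_section I X).1 hX
  refine (h1.clm_apply h2).congr_of_eventuallyEq ?_
  filter_upwards [(chartAt H p).open_source.mem_nhds (mem_chart_source H p)] with y hy
  exact (coordDeriv_trivializationAt f p hy (X y)).symm

/-- In a trivialization at `p` the differential is a smooth family `L y` of linear maps. A left
inverse `K` of `L p` makes `K ∘ L y` invertible near `p`, with smooth inverse, and the coordinates
of `X` are `(K ∘ L y)⁻¹ K (df X)`. -/
theorem contMDiffAt_section_of_mvfderiv [IsManifold I ∞ M] [FiniteDimensional ℝ E]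
    [FiniteDimensional ℝ F] {f : M → F} {p : M}
    (hf : ContMDiffAt I 𝓘(ℝ, F) ∞ f p) (hinj : Function.Injective (mvfderiv I f p))
    {X : Π y : M, TangentSpace I y}
    (hX : ContMDiffAt I 𝓘(ℝ, F) ∞ (fun y ↦ mvfderiv I f y (X y)) p) :
    ContMDiffAt I (I.prod 𝓘(ℝ, E)) ∞ (fun y ↦ TotalSpace.mk' E y (X y)) p := by
  have : IsManifold I 1 M := .of_le (n := ∞) (by simp)
  have : CompleteSpace E := FiniteDimensional.complete ℝ E
  rw [contMDiffAt_section]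
  set L := coordDeriv I f p with hL
  have h1 : ContMDiffAt I 𝓘(ℝ, E →L[ℝ] F) ∞ L p := contMDiffAt_coordDeriv hf
  have hLp : ∀ v : E, L p v = mvfderiv I f p v := coordDeriv_self_apply f p
  have hker : LinearMap.ker (L p : E →ₗ[ℝ] F) = ⊥ := by
    rw [LinearMap.ker_eq_bot]
    intro v w hvw
    apply hinj
    rw [← hLp v, ← hLp w]
    exact hvw
  obtain ⟨K₀, hK₀⟩ := LinearMap.exists_leftInverse_of_injective _ hker
  set K : F →L[ℝ] E := K₀.toContinuousLinearMap with hKdef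
  have hK : ∀ v, K (L p v) = v := fun v ↦ congr($hK₀ v)
  have h2 : ContMDiffAt I 𝓘(ℝ, E →L[ℝ] E) ∞ (fun y ↦ K.comp (L y)) p :=
    contMDiffAt_const.clm_comp h1
  have hKp : K.comp (L p) = ContinuousLinearEquiv.refl ℝ E := by ext v; exact hK v
  have h3 : ContMDiffAt I 𝓘(ℝ, E →L[ℝ] E) ∞ (fun y ↦ (K.comp (L y)).inverse) p := by
    have := contDiffAt_map_inverse (n := ∞) (ContinuousLinearEquiv.refl ℝ E)
    rw [← hKp] at this
    exact this.contMDiffAt.comp p h2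
  have h4 : ContMDiffAt I 𝓘(ℝ, E) ∞
      (fun y ↦ (K.comp (L y)).inverse (K (mvfderiv I f y (X y)))) p :=
    h3.clm_apply ((contMDiffAt_const (c := K)).clm_apply hX)
  refine h4.congr_of_eventuallyEq ?_
  have h5 : ∀ᶠ y in 𝓝 p, K.comp (L y) ∈ Set.range ((↑) : (E ≃L[ℝ] E) → E →L[ℝ] E) := by
    refine h2.continuousAt.eventually_mem ?_
    rw [hKp]
    exact ContinuousLinearEquiv.nhds _
  filter_upwards [(chartAt H p).open_source.mem_nhds (mem_chart_source H p), h5] with y hy hy'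
  obtain ⟨e, he⟩ := hy'
  rw [← coordDeriv_trivializationAt f p hy (X y), ← hL]
  change _ = (K.comp (L y)).inverse ((K.comp (L y)) _)
  rw [← he, ContinuousLinearMap.inverse_equiv]
  simp

end Immersion

/-! ### The inclusion of `U` in `ℝ^{n+1}` and its differential -/

variable {n : ℕ} {U : Opens (Sph n)}

instance : Fact (Module.finrank ℝ (EuclideanSpace ℝ (Fin (n + 1))) = n + 1) :=
  ⟨by simp⟩

theorem contMDiff_incl : ContMDiff (𝓡 n) 𝓘(ℝ, EuclideanSpace ℝ (Fin (n + 1))) ∞ (incl U) :=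
  contMDiff_coe_sphere.comp contMDiff_subtype_val

theorem norm_incl (x : U) : ‖incl U x‖ = 1 := by
  simp [incl]

theorem inner_incl_self (x : U) : ⟪incl U x, incl U x⟫_ℝ = 1 := by
  rw [real_inner_self_eq_norm_sq, norm_incl]; norm_num

/-- The differential of the inclusion of `U` in `ℝ^{n+1}`. -/
abbrev dincl (x : U) : TangentSpace (𝓡 n) x →L[ℝ] EuclideanSpace ℝ (Fin (n + 1)) :=
  mvfderiv (𝓡 n) (incl U) x

/-- The projection onto the orthogonal complement of `x`. -/
def tproj (x : U) : EuclideanSpace ℝ (Fin (n + 1)) →L[ℝ] EuclideanSpace ℝ (Fin (n + 1)) :=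
  ContinuousLinearMap.id ℝ _ - (innerSL ℝ (incl U x)).smulRight (incl U x)

theorem tproj_apply (x : U) (w : EuclideanSpace ℝ (Fin (n + 1))) :
    tproj x w = w - ⟪incl U x, w⟫_ℝ • incl U x := by
  simp [tproj]

theorem dincl_eq_comp (x : U) : dincl x =
    (mvfderiv (𝓡 n) ((↑) : Sph n → EuclideanSpace ℝ (Fin (n + 1))) (x : Sph n)).comp
      (mfderiv (𝓡 n) (𝓡 n) (Subtype.val : U → Sph n) x) :=
  mfderiv_comp x ((contMDiff_coe_sphere (E := EuclideanSpace ℝ (Fin (n + 1))) (m := 1) (n := n)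
    _).mdifferentiableAt one_ne_zero)
    ((contMDiff_subtype_val (n := 1) x).mdifferentiableAt one_ne_zero)

open Classical in
/-- The identity of `U`, extended to the sphere by a constant. -/
def toOpens (p : U) (y : Sph n) : U := if h : y ∈ U then ⟨y, h⟩ else p

theorem val_toOpens (p : U) {y : Sph n} (hy : y ∈ U) : (toOpens p y : Sph n) = y := by
  simp [toOpens, hy]

theorem toOpens_val (p y : U) : toOpens p (y : Sph n) = y := Subtype.ext (val_toOpens p y.2)

theorem contMDiffAt_toOpens (p y : U) : ContMDiffAt (𝓡 n) (𝓡 n) ∞ (toOpens p) (y : Sph n) := by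
  rw [← ContMDiffAt.subtypeVal_comp_iff]
  refine contMDiffAt_id.congr_of_eventuallyEq ?_
  filter_upwards [U.isOpen.mem_nhds y.2] with z hz using val_toOpens p hz

/-- `toOpens x` is a local inverse of the inclusion, so the chain rule for both composites gives a
two-sided inverse of the differential. -/
theorem mfderiv_val_bijective (x : U) :
    Function.Bijective (mfderiv (𝓡 n) (𝓡 n) (Subtype.val : U → Sph n) x) := by
  have hv : MDifferentiableAt (𝓡 n) (𝓡 n) (Subtype.val : U → Sph n) x :=
    (contMDiff_subtype_val (n := 1) x).mdifferentiableAt one_ne_zero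
  have hr : MDifferentiableAt (𝓡 n) (𝓡 n) (toOpens x) (x : Sph n) :=
    (contMDiffAt_toOpens x x).mdifferentiableAt (by simp)
  have h1 := mfderiv_comp x hr hv
  have h2 := mfderiv_comp_of_eq (x := (x : Sph n)) (y := x) hv hr (toOpens_val x x)
  rw [toOpens_val] at h2
  have e1 : toOpens x ∘ (Subtype.val : U → Sph n) = id := funext fun y ↦ toOpens_val x y
  have e2 : (Subtype.val : U → Sph n) ∘ toOpens x =ᶠ[𝓝 (x : Sph n)] id := by
    filter_upwards [U.isOpen.mem_nhds x.2] with z hz using val_toOpens x hz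
  rw [e1, mfderiv_id] at h1
  rw [e2.mfderiv_eq, mfderiv_id] at h2
  refine ⟨fun v w hvw ↦ ?_, fun w ↦ ⟨mfderiv (𝓡 n) (𝓡 n) (toOpens x) (x : Sph n) w, ?_⟩⟩
  · have hv := congr($h1 v)
    have hw := congr($h1 w)
    exact hv.trans ((congrArg (mfderiv (𝓡 n) (𝓡 n) (toOpens x) (x : Sph n)) hvw).trans hw.symm)
  · exact congr($h2 w).symm

theorem inner_incl_dincl (x : U) (X : TangentSpace (𝓡 n) x) :
    ⟪incl U x, dincl x X⟫_ℝ = 0 := by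
  have h : dincl x X ∈ (ℝ ∙ ((x : Sph n) : EuclideanSpace ℝ (Fin (n + 1))))ᗮ := by
    rw [← range_mvfderiv_subtypeVal (n := n), dincl_eq_comp]
    exact ⟨_, rfl⟩
  exact Submodule.mem_orthogonal_singleton_iff_inner_right.1 h

theorem dincl_injective (x : U) : Function.Injective (dincl x) := by
  rw [dincl_eq_comp]
  exact (injective_mvfderiv_subtypeVal_sphere _).comp (mfderiv_val_bijective x).1

theorem exists_dincl_eq (x : U) {w : EuclideanSpace ℝ (Fin (n + 1))} (hw : ⟪incl U x, w⟫_ℝ = 0) :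
    ∃ X, dincl x X = w := by
  have h : w ∈ (ℝ ∙ ((x : Sph n) : EuclideanSpace ℝ (Fin (n + 1))))ᗮ :=
    Submodule.mem_orthogonal_singleton_iff_inner_right.2 hw
  rw [← range_mvfderiv_subtypeVal (n := n)] at h
  obtain ⟨Y, hY⟩ := h
  obtain ⟨X, rfl⟩ := (mfderiv_val_bijective x).2 Y
  exact ⟨X, by rw [dincl_eq_comp]; exact hY⟩

end

/-! ### Tangential projection, and tensors extended to `ℝ^{n+1}` -/

section

variable {n : ℕ} {U : Opens (Sph n)}

instance instFiniteDimensionalTangentSpace (x : U) : FiniteDimensional ℝ (TangentSpace (𝓡 n) x) :=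
  inferInstanceAs (FiniteDimensional ℝ (EuclideanSpace ℝ (Fin n)))

theorem finrank_tangentSpace (x : U) : Module.finrank ℝ (TangentSpace (𝓡 n) x) = n :=
  finrank_euclideanSpace_fin (𝕜 := ℝ) (n := n)

theorem inner_incl_tproj (x : U) (w : EuclideanSpace ℝ (Fin (n + 1))) : ⟪incl U x,
    tproj x w⟫_ℝ = 0 := by
  rw [tproj_apply, inner_sub_right, inner_smul_right, inner_incl_self]; ring

theorem tproj_dincl (x : U) (X : TangentSpace (𝓡 n) x) : tproj x (dincl x X) = dincl x X := by
  rw [tproj_apply, inner_incl_dincl]; simp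

/-- The orthogonal projection of `ℝ^{n+1}` onto the tangent space of `U` at `x`. -/
def toTangent (x : U) : (EuclideanSpace ℝ (Fin (n + 1))) →L[ℝ] TangentSpace (𝓡 n) x :=
  -- The chosen left inverse is arbitrary off the range of `dincl x`; composing with `tproj x` makes
  -- the choice irrelevant.
  LinearMap.toContinuousLinearMap
    ((LinearMap.exists_leftInverse_of_injective (dincl x : TangentSpace (𝓡 n) x →ₗ[ℝ]
        (EuclideanSpace ℝ (Fin (n + 1))))
      (LinearMap.ker_eq_bot.2 (dincl_injective x))).choose ∘ₗ (tproj x : (EuclideanSpace ℝ (Fin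
          (n + 1))) →ₗ[ℝ] (EuclideanSpace ℝ (Fin (n + 1)))))

theorem toTangent_dincl (x : U) (X : TangentSpace (𝓡 n) x) : toTangent x (dincl x X) = X := by
  have h := (LinearMap.exists_leftInverse_of_injective (dincl x : TangentSpace (𝓡 n) x →ₗ[ℝ]
      (EuclideanSpace ℝ (Fin (n + 1))))
      (LinearMap.ker_eq_bot.2 (dincl_injective x))).choose_spec
  have h' := congr($h X)
  simp only [LinearMap.comp_apply] at h'
  simp only [toTangent, LinearMap.coe_toContinuousLinearMap', LinearMap.comp_apply]
  erw [tproj_dincl]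
  exact h'

theorem dincl_toTangent (x : U) (w : EuclideanSpace ℝ (Fin (n + 1))) : dincl x
    (toTangent x w) = tproj x w := by
  obtain ⟨X, hX⟩ := exists_dincl_eq x (inner_incl_tproj x w)
  have : toTangent x w = toTangent x (dincl x X) := by
    have h2 : tproj x (dincl x X) = tproj x w := by rw [tproj_dincl, hX]
    simp only [toTangent, LinearMap.coe_toContinuousLinearMap', LinearMap.comp_apply]
    exact congrArg _ h2.symm
  rw [this, toTangent_dincl, hX]

theorem toTangent_tproj (x : U) (w : EuclideanSpace ℝ (Fin (n + 1))) : toTangent x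
    (tproj x w) = toTangent x w := by
  rw [← dincl_toTangent, toTangent_dincl]

theorem toTangent_incl (x : U) : toTangent x (incl U x) = 0 := by
  rw [← toTangent_tproj, tproj_apply, inner_incl_self]; simp

theorem inner_dincl_toTangent (x : U) (X : TangentSpace (𝓡 n) x) (w : EuclideanSpace ℝ (Fin
    (n + 1))) :
    ⟪dincl x X, dincl x (toTangent x w)⟫_ℝ = ⟪dincl x X, w⟫_ℝ := by
  rw [dincl_toTangent, tproj_apply, inner_sub_right, inner_smul_right,
    real_inner_comm (incl U x) (dincl x X), inner_incl_dincl]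
  ring

theorem contMDiff_height (v : EuclideanSpace ℝ (Fin (n + 1))) : ContMDiff (𝓡 n) 𝓘(ℝ) ∞
    (height U v) := by
  have h : ContMDiff (𝓡 n) 𝓘(ℝ) ∞ fun x : U ↦ innerSL ℝ v (incl U x) :=
    (innerSL ℝ v).contDiff.contMDiff.comp contMDiff_incl
  refine h.congr fun x ↦ ?_
  rw [height, real_inner_comm, innerSL_apply_apply]

theorem contMDiff_tproj_apply (w : EuclideanSpace ℝ (Fin (n + 1))) : ContMDiff (𝓡 n) 𝓘(ℝ,
    EuclideanSpace ℝ (Fin (n + 1))) ∞ fun x : U ↦ tproj x w := by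
  simp only [tproj_apply]
  exact contMDiff_const.sub ((contMDiff_height w).smul contMDiff_incl)

theorem smoothAt_of_dincl {X : VField U} {p : U}
    (hX : ContMDiffAt (𝓡 n) 𝓘(ℝ, EuclideanSpace ℝ (Fin (n + 1))) ∞ (fun y ↦ dincl y (X y)) p) :
        SmoothAt X p :=
  contMDiffAt_section_of_mvfderiv (contMDiff_incl p) (dincl_injective p) hX

theorem SmoothAt.diffAt {X : VField U} {p : U} (h : SmoothAt X p) : DiffAt X p :=
  ContMDiffAt.mdifferentiableAt h (by simp)

theorem DiffAt.dincl {X : VField U} {p : U} (h : DiffAt X p) :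
    MDifferentiableAt (𝓡 n) 𝓘(ℝ, EuclideanSpace ℝ (Fin (n + 1))) (fun y ↦ dincl y (X y)) p :=
  mdifferentiableAt_mvfderiv_apply (contMDiff_incl p) h

/-- The tangential part of a constant vector field of `ℝ^{n+1}`. -/
def tfield (U : Opens (Sph n)) (w : EuclideanSpace ℝ (Fin (n + 1))) : VField U :=
    fun x ↦ toTangent x w

theorem smoothAt_tfield (w : EuclideanSpace ℝ (Fin (n + 1))) (p : U) : SmoothAt (tfield U w) p := by
  refine smoothAt_of_dincl ?_
  simp only [tfield, dincl_toTangent]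
  exact contMDiff_tproj_apply w p

theorem tfield_dincl (p : U) (X : TangentSpace (𝓡 n) p) : tfield U (dincl p X) p = X :=
  toTangent_dincl p X

/-- A two-tensor field, extended by zero to the normal direction. -/
def ext2 (g : Tensor2 U) (x : U) : (EuclideanSpace ℝ (Fin (n + 1))) →L[ℝ] (EuclideanSpace ℝ (Fin
    (n + 1))) →L[ℝ] ℝ :=
  (ContinuousLinearMap.precomp ℝ (toTangent x)).comp ((g x).comp (toTangent x))

theorem ext2_apply (g : Tensor2 U) (x : U) (v w : EuclideanSpace ℝ (Fin (n + 1))) :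
    ext2 g x v w = g x (toTangent x v) (toTangent x w) := rfl

theorem ext2_dincl (g : Tensor2 U) (x : U) (X Y : TangentSpace (𝓡 n) x) :
    ext2 g x (dincl x X) (dincl x Y) = g x X Y := by
  rw [ext2_apply, toTangent_dincl, toTangent_dincl]

/-- The two-tensor field `g` is smooth. -/
def SmoothTensor (g : Tensor2 U) : Prop :=
  ContMDiff (𝓡 n) 𝓘(ℝ, (EuclideanSpace ℝ (Fin (n + 1))) →L[ℝ] (EuclideanSpace ℝ (Fin
      (n + 1))) →L[ℝ] ℝ) ∞ (ext2 g)

theorem ext2_roundMetric (x : U) (v w : EuclideanSpace ℝ (Fin (n + 1))) :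
    ext2 (roundMetric U) x v w = ⟪v, w⟫_ℝ - height U v x * height U w x := by
  rw [ext2_apply, roundMetric_apply]
  change ⟪dincl x _, dincl x _⟫_ℝ = _
  rw [inner_dincl_toTangent, dincl_toTangent, tproj_apply, inner_sub_left, inner_smul_left]
  rfl

/-- A bilinear form on `ℝ^{n+1}` is a finite combination of fixed forms whose coefficients are its
values on the standard basis. -/
theorem contMDiff_bilin {f : U → (EuclideanSpace ℝ (Fin (n + 1))) →L[ℝ] (EuclideanSpace ℝ (Fin
    (n + 1))) →L[ℝ] ℝ}
    (h : ∀ v w, ContMDiff (𝓡 n) 𝓘(ℝ) ∞ fun x ↦ f x v w) :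
    ContMDiff (𝓡 n) 𝓘(ℝ, (EuclideanSpace ℝ (Fin (n + 1))) →L[ℝ] (EuclideanSpace ℝ (Fin
        (n + 1))) →L[ℝ] ℝ) ∞ f := by
  have key : f = fun x ↦ ∑ i, ∑ j,
      f x (EuclideanSpace.basisFun _ ℝ i) (EuclideanSpace.basisFun _ ℝ j) •
        (EuclideanSpace.proj (𝕜 := ℝ) i).smulRight (EuclideanSpace.proj (𝕜 := ℝ) j) := by
    ext x v w
    conv_lhs => rw [← (EuclideanSpace.basisFun _ ℝ).sum_repr v,
      ← (EuclideanSpace.basisFun _ ℝ).sum_repr w]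
    simp only [map_sum, map_smul, _root_.sum_apply, _root_.smul_apply,
      ContinuousLinearMap.smulRight_apply, EuclideanSpace.basisFun_repr, smul_eq_mul]
    simp_rw [Finset.mul_sum]
    rw [Finset.sum_comm]
    refine Finset.sum_congr rfl fun i _ ↦ Finset.sum_congr rfl fun j _ ↦ ?_
    change _ = _ * (v.ofLp i * w.ofLp j)
    ring
  rw [key]
  refine contMDiff_finsetSum (I := 𝓘(ℝ, (EuclideanSpace ℝ (Fin (n + 1))) →L[ℝ] (EuclideanSpace ℝ
      (Fin (n + 1))) →L[ℝ] ℝ)) fun i _ ↦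
    contMDiff_finsetSum (I := 𝓘(ℝ, (EuclideanSpace ℝ (Fin (n + 1))) →L[ℝ] (EuclideanSpace ℝ (Fin
        (n + 1))) →L[ℝ] ℝ)) fun j _ ↦ ?_
  exact (h _ _).smul contMDiff_const

theorem smoothTensor_roundMetric : SmoothTensor (roundMetric U) := by
  refine contMDiff_bilin fun v w ↦ ?_
  simp only [ext2_roundMetric]
  exact contMDiff_const.sub ((contMDiff_height v).mul (contMDiff_height w))

theorem contMDiffAt_posTensor_apply (g : PosTensor U) {X Y : VField U} {p : U} (hX : SmoothAt X p)
    (hY : SmoothAt Y p) : ContMDiffAt (𝓡 n) 𝓘(ℝ) ∞ (fun x ↦ g.inner x (X x) (Y x)) p := by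
  have h := ContMDiffAt.clm_bundle_apply₂ (F₁ := EuclideanSpace ℝ (Fin n))
    (F₂ := EuclideanSpace ℝ (Fin n)) (F₃ := ℝ) (E₃ := Bundle.Trivial U ℝ)
    (g.contMDiff p) hX hY
  simp only [contMDiffAt_totalSpace] at h
  exact h.2

theorem smoothTensor_inner (g : PosTensor U) : SmoothTensor g.inner :=
  contMDiff_bilin fun v w x ↦ contMDiffAt_posTensor_apply g (smoothAt_tfield v x)
      (smoothAt_tfield w x)

end

section

/-! ### Product rule and commuting vector fields -/

section Calculus

variable {E : Type*} [NormedAddCommGroup E] [NormedSpace ℝ E]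
  {H : Type*} [TopologicalSpace H] {I : ModelWithCorners ℝ E H}
  {M : Type*} [TopologicalSpace M] [ChartedSpace H M]
  {F : Type*} [NormedAddCommGroup F] [NormedSpace ℝ F]
  {G : Type*} [NormedAddCommGroup G] [NormedSpace ℝ G]

theorem mvfderiv_clm_apply {B : M → F →L[ℝ] G} {f : M → F} {x : M}
    (hB : MDifferentiableAt I 𝓘(ℝ, F →L[ℝ] G) B x) (hf : MDifferentiableAt I 𝓘(ℝ, F) f x)
    (v : TangentSpace I x) :
    mvfderiv I (fun y ↦ B y (f y)) x v = mvfderiv I B x v (f x) + B x (mvfderiv I f x v) := by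
  let B' : E →L[ℝ] F →L[ℝ] G := mvfderiv I B x
  let f' : E →L[ℝ] F := mvfderiv I f x
  have hB' : HasFDerivWithinAt (writtenInExtChartAt I 𝓘(ℝ, F →L[ℝ] G) x B) B' (Set.range I)
      (extChartAt I x x) := hB.hasMFDerivAt.2
  have hf' : HasFDerivWithinAt (writtenInExtChartAt I 𝓘(ℝ, F) x f) f' (Set.range I)
      (extChartAt I x x) := hf.hasMFDerivAt.2
  have h : HasMFDerivAt I 𝓘(ℝ, G) (fun y ↦ B y (f y)) x ((B x).comp f' + B'.flip (f x)) := by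
    refine ⟨hB.continuousAt.clm_apply hf.continuousAt, ?_⟩
    have h0 : writtenInExtChartAt I 𝓘(ℝ, F →L[ℝ] G) x B (extChartAt I x x) = B x := by
      simp [writtenInExtChartAt]
      rfl
    have h1 : writtenInExtChartAt I 𝓘(ℝ, F) x f (extChartAt I x x) = f x := by
      simp [writtenInExtChartAt]
      rfl
    have h2 := hB'.clm_apply hf'
    rw [h0, h1] at h2
    exact h2
  rw [mvfderiv, h.mfderiv, add_comm]
  rfl

theorem mvfderiv_clm_comp (A : F →L[ℝ] G) {f : M → F} {x : M}
    (hf : MDifferentiableAt I 𝓘(ℝ, F) f x) (v : TangentSpace I x) :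
    mvfderiv I (fun y ↦ A (f y)) x v = A (mvfderiv I f x v) := by
  rw [mvfderiv_clm_apply mdifferentiableAt_const hf, mvfderiv_const]
  simp

theorem mvfderiv_congr {f g : M → F} {x : M} (h : f =ᶠ[𝓝 x] g) :
    mvfderiv I f x = mvfderiv I g x := by
  rw [mvfderiv, mvfderiv, h.mfderiv_eq, h.eq_of_nhds]

/-- Torsion is tensorial, so it may be tested on such fields. They are the pullbacks of constant
fields by the chart at `p`; iterated derivatives along them are second derivatives in the chart,
hence symmetric. -/
theorem exists_commuting_fields [I.Boundaryless] [IsManifold I ∞ M] [CompleteSpace E] (p : M)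
    (u v : TangentSpace I p) : ∃ X Y : Π y : M, TangentSpace I y,
      MDifferentiableAt I (I.prod 𝓘(ℝ, E)) (fun y ↦ TotalSpace.mk' E y (X y)) p ∧
      MDifferentiableAt I (I.prod 𝓘(ℝ, E)) (fun y ↦ TotalSpace.mk' E y (Y y)) p ∧
      X p = u ∧ Y p = v ∧ VectorField.mlieBracket I X Y p = 0 ∧
      ∀ f : M → F, ContMDiff I 𝓘(ℝ, F) ∞ f →
        mvfderiv I (fun y ↦ mvfderiv I f y (Y y)) p u =
          mvfderiv I (fun y ↦ mvfderiv I f y (X y)) p v := by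
  have i1 : IsManifold I 1 M := .of_le (n := ∞) (by simp)
  have i2 : IsManifold I 2 M := .of_le (n := ∞) (by norm_cast)
  have i3 : IsManifold I (minSmoothness ℝ 3) M := .of_le (n := ∞) (by simp; norm_cast)
  set φ := extChartAt I p with hφ
  let c (w : E) : Π y : E, TangentSpace 𝓘(ℝ, E) y := fun _ ↦ w
  have hc (w : E) (z : E) : MDifferentiableAt 𝓘(ℝ, E) (𝓘(ℝ, E).prod 𝓘(ℝ, E))
      (fun y ↦ TotalSpace.mk' E y (c w y)) z :=
    (contMDiffAt_vectorSpace_iff_contDiffAt (n := 1).2 contDiffAt_const).mdifferentiableAt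
      one_ne_zero
  let X (w : E) : Π y : M, TangentSpace I y := VectorField.mpullback I 𝓘(ℝ, E) φ (c w)
  have hX (w : E) : MDifferentiableAt I (I.prod 𝓘(ℝ, E))
      (fun y ↦ TotalSpace.mk' E y (X w y)) p :=
    (hc w (φ p)).mpullback_vectorField (n := ∞) contMDiffAt_extChartAt
      (isInvertible_mfderiv_extChartAt (mem_extChartAt_source p)) (ENat.LEInfty.out)
  -- The tangent space at `p` is modelled on the preferred chart at `p`, whose differential there is
  -- the identity.
  have hXp (w : E) : X w p = w := by
    change (mfderiv I 𝓘(ℝ, E) (extChartAt I p) p).inverse w = w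
    rw [mfderiv_extChartAt_self]
    exact congr($(ContinuousLinearMap.inverse_id) w)
  have hbr (w w' : E) : VectorField.mlieBracket I (X w) (X w') p = 0 := by
    rw [← VectorField.mpullback_mlieBracket (n := ∞) (hc w _) (hc w' _) contMDiffAt_extChartAt
        (by simp; exact ENat.LEInfty.out)]
    have h0 : VectorField.mlieBracket 𝓘(ℝ, E) (c w) (c w') = 0 := by
      rw [← VectorField.mlieBracketWithin_univ, VectorField.mlieBracketWithin_eq_lieBracketWithin]
      ext z
      simp [VectorField.lieBracketWithin, c]
      rfl
    rw [h0, VectorField.mpullback_zero]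
    rfl
  have hsm (f : M → F) (hf : ContMDiff I 𝓘(ℝ, F) ∞ f) : ∀ z ∈ φ.target,
      ContDiffAt ℝ ∞ (f ∘ φ.symm) z := fun z hz ↦
    contMDiffAt_iff_contDiffAt.1 ((hf _).comp z ((contMDiffOn_extChartAt_symm p).contMDiffAt
      ((isOpen_extChartAt_target p).mem_nhds hz)))
  have key (f : M → F) (hf : ContMDiff I 𝓘(ℝ, F) ∞ f) (w : E) (w' : E) :
      mvfderiv I (fun y ↦ mvfderiv I f y (X w y)) p w' =
        fderiv ℝ (fderiv ℝ (f ∘ φ.symm)) (φ p) w' w := by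
    have h1 : (fun y ↦ mvfderiv I f y (X w y)) =ᶠ[𝓝 p]
        fun y ↦ fderiv ℝ (f ∘ φ.symm) (φ y) w := by
      filter_upwards [extChartAt_source_mem_nhds (I := I) p] with y hy
      have hi := isInvertible_mfderiv_extChartAt hy
      have h2 : f =ᶠ[𝓝 y] (f ∘ φ.symm) ∘ φ := by
        filter_upwards [(isOpen_extChartAt_source p).mem_nhds hy] with z hz
        exact congrArg f ((extChartAt I p).left_inv hz).symm
      have h3 : mvfderiv I f y (X w y) = mvfderiv I ((f ∘ φ.symm) ∘ φ) y (X w y) := by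
        rw [mvfderiv_congr h2]
      have h4 : mfderiv I 𝓘(ℝ, F) ((f ∘ φ.symm) ∘ φ) y =
          (mfderiv 𝓘(ℝ, E) 𝓘(ℝ, F) (f ∘ φ.symm) (φ y)).comp (mfderiv I 𝓘(ℝ, E) φ y) :=
        mfderiv_comp y ((hsm f hf _ (φ.map_source hy)).differentiableAt (by simp)).mdifferentiableAt
          (mdifferentiableAt_extChartAt (by simpa using hy))
      rw [h3]
      refine (congr($h4 (X w y))).trans ?_
      rw [mfderiv_eq_fderiv]
      refine congrArg (fderiv ℝ (f ∘ φ.symm) (φ y)) ?_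
      exact hi.self_apply_inverse w
    rw [mvfderiv_congr h1]
    have h5 : ContDiffAt ℝ ∞ (f ∘ φ.symm) (φ p) := hsm f hf _ (mem_extChartAt_target p)
    have h6 : DifferentiableAt ℝ (fderiv ℝ (f ∘ φ.symm)) (φ p) :=
      (h5.fderiv_right (m := 1) (ENat.LEInfty.out (m := 2))).differentiableAt one_ne_zero
    have h7 : DifferentiableAt ℝ (fun z ↦ fderiv ℝ (f ∘ φ.symm) z w) (φ p) :=
      h6.clm_apply (differentiableAt_const w)
    have h8 : mfderiv I 𝓘(ℝ, F) ((fun z ↦ fderiv ℝ (f ∘ φ.symm) z w) ∘ φ) p =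
        (mfderiv 𝓘(ℝ, E) 𝓘(ℝ, F) (fun z ↦ fderiv ℝ (f ∘ φ.symm) z w) (φ p)).comp
          (mfderiv I 𝓘(ℝ, E) φ p) :=
      mfderiv_comp p h7.mdifferentiableAt (mdifferentiableAt_extChartAt (mem_chart_source H p))
    refine (congr($h8 w')).trans ?_
    rw [mfderiv_eq_fderiv, mfderiv_extChartAt_self]
    change fderiv ℝ (fun z ↦ fderiv ℝ (f ∘ φ.symm) z w) (φ p) w' = _
    rw [fderiv_clm_apply h6 (differentiableAt_const w)]
    simp
  refine ⟨X u, X v, hX u, hX v, hXp u, hXp v, hbr u v, fun f hf ↦ ?_⟩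
  refine (key f hf v u).trans (Eq.trans ?_ (key f hf u v).symm)
  exact ((hsm f hf _ (mem_extChartAt_target p)).isSymmSndFDerivAt
    (by simp; exact ENat.LEInfty.out)).eq _ _

end Calculus

end

/-! ### The round connection and the Koszul formula relative to it -/

section

variable {n : ℕ} {U : Opens (Sph n)}

/-- The covariant derivative of the round metric: the tangential part of the derivative in
`ℝ^{n+1}`. -/
def roundCov (U : Opens (Sph n)) : CovariantDerivative (𝓡 n) (EuclideanSpace ℝ (Fin n))
    (fun x : U ↦ TangentSpace (𝓡 n) x) where
  toFun Y x := (toTangent x).comp (mvfderiv (𝓡 n) (fun y ↦ dincl y (Y y)) x)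
  isCovariantDerivativeOnUniv := by
    constructor
    · intro X Y x hX hY _
      have h := mvfderiv_add (DiffAt.dincl hX) (DiffAt.dincl hY)
      have e : (fun y ↦ dincl y ((X + Y) y)) =
          (fun y ↦ dincl y (X y)) + fun y ↦ dincl y (Y y) := by
        ext1 y; exact map_add _ _ _
      rw [e, h, ContinuousLinearMap.comp_add]
    · intro X f x hX hf _
      have h := mvfderiv_smul hf (DiffAt.dincl hX)
      have e : (fun y ↦ dincl y ((f • X) y)) = f • fun y ↦ dincl y (X y) := by
        ext1 y; exact (dincl y).map_smul (f y) (X y)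
      rw [e, h]
      ext1 v
      change toTangent x (f x • _ + (mvfderiv (𝓡 n) f x v) • dincl x (X x)) = _
      rw [map_add, map_smul, map_smul, toTangent_dincl]
      rfl

theorem roundCov_apply (Y : VField U) (x : U) (v : TangentSpace (𝓡 n) x) :
    roundCov U Y x v = toTangent x (mvfderiv (𝓡 n) (fun y ↦ dincl y (Y y)) x v) := rfl

/-- On commuting fields the torsion is the tangential part of the antisymmetrised second derivative
of `incl`, which is zero. -/
theorem torsion_roundCov : (roundCov U).torsion = 0 := by
  ext x u v
  obtain ⟨X, Y, hX, hY, rfl, rfl, hb, h⟩ := exists_commuting_fields (I := 𝓡 n)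
    (F := EuclideanSpace ℝ (Fin (n + 1))) x u v
  rw [CovariantDerivative.torsion_apply _ hX hY, hb, roundCov_apply, roundCov_apply,
    h _ contMDiff_incl]
  simp

/-- The covariant derivative `(∇_Z g)(X, Y)` of a two-tensor in the round metric. -/
def covTensor (g : Tensor2 U) (x : U) : TangentSpace (𝓡 n) x →ₗ[ℝ] TangentSpace (𝓡 n) x →ₗ[ℝ]
    TangentSpace (𝓡 n) x →ₗ[ℝ] ℝ :=
  LinearMap.mk₂ ℝ (fun Z X ↦
    ((mvfderiv (𝓡 n) (ext2 g) x Z (dincl x X)).comp (dincl x) : TangentSpace (𝓡 n) x →ₗ[ℝ] ℝ))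
    (fun Z Z' X ↦ by
      ext Y
      exact congr($((mvfderiv (𝓡 n) (ext2 g) x).map_add Z Z') (dincl x X) (dincl x Y)))
    (fun c Z X ↦ by
      ext Y
      exact congr($((mvfderiv (𝓡 n) (ext2 g) x).map_smul c Z) (dincl x X) (dincl x Y)))
    (fun Z X X' ↦ by
      ext Y
      change mvfderiv (𝓡 n) (ext2 g) x Z (dincl x (X + X')) (dincl x Y) = _
      rw [map_add, map_add]; rfl)
    (fun c Z X ↦ by
      ext Y
      change mvfderiv (𝓡 n) (ext2 g) x Z (dincl x (c • X)) (dincl x Y) = _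
      rw [map_smul, map_smul]; rfl)

theorem covTensor_apply (g : Tensor2 U) (x : U) (Z X Y : TangentSpace (𝓡 n) x) :
    covTensor g x Z X Y = mvfderiv (𝓡 n) (ext2 g) x Z (dincl x X) (dincl x Y) := rfl

theorem SmoothTensor.mdifferentiableAt {g : Tensor2 U} (hg : SmoothTensor g) (x : U) :
    MDifferentiableAt (𝓡 n) 𝓘(ℝ, (EuclideanSpace ℝ (Fin (n + 1))) →L[ℝ] (EuclideanSpace ℝ (Fin
        (n + 1))) →L[ℝ] ℝ) (ext2 g) x :=
  ContMDiff.mdifferentiable hg (by simp) x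

theorem mvfderiv_ext2_apply {g : Tensor2 U} (hg : SmoothTensor g) (x : U)
    (Z : TangentSpace (𝓡 n) x) (v w : EuclideanSpace ℝ (Fin (n + 1))) :
    mvfderiv (𝓡 n) (ext2 g) x Z v w = mvfderiv (𝓡 n) (fun y ↦ ext2 g y v w) x Z := by
  rw [mvfderiv_clm_apply ((hg.mdifferentiableAt x).clm_apply mdifferentiableAt_const)
    mdifferentiableAt_const, mvfderiv_clm_apply (hg.mdifferentiableAt x) mdifferentiableAt_const,
    mvfderiv_const, mvfderiv_const]
  simp

theorem covTensor_symm {g : Tensor2 U} (hg : SmoothTensor g) (hs : ∀ x X Y, g x X Y = g x Y X)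
    (x : U) (Z X Y : TangentSpace (𝓡 n) x) : covTensor g x Z X Y = covTensor g x Z Y X := by
  rw [covTensor_apply, covTensor_apply, mvfderiv_ext2_apply hg, mvfderiv_ext2_apply hg]
  simp only [ext2_apply, hs _ (toTangent _ (dincl x X))]

/-- This identifies `covTensor` with the covariant derivative for `roundCov`. In the product rule
for `ext2 g`, only the tangential parts of the derivatives of `dincl X` and `dincl Y` survive, and
these are `roundCov`. -/
theorem mvfderiv_tensor_apply {g : Tensor2 U} (hg : SmoothTensor g) {X Y : VField U} {x : U}
    (hX : DiffAt X x) (hY : DiffAt Y x) (Z : TangentSpace (𝓡 n) x) :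
    mvfderiv (𝓡 n) (fun y ↦ g y (X y) (Y y)) x Z = covTensor g x Z (X x) (Y x) +
      g x (roundCov U X x Z) (Y x) + g x (X x) (roundCov U Y x Z) := by
  have e : (fun y ↦ g y (X y) (Y y)) = fun y ↦ ext2 g y (dincl y (X y)) (dincl y (Y y)) := by
    ext1 y; rw [ext2_dincl]
  rw [e, mvfderiv_clm_apply ((hg.mdifferentiableAt x).clm_apply hX.dincl) hY.dincl,
    mvfderiv_clm_apply (hg.mdifferentiableAt x) hX.dincl, covTensor_apply]
  simp only [_root_.add_apply, ext2_apply, toTangent_dincl, roundCov_apply]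

theorem covDerivTensor_roundCov {g : Tensor2 U} (hg : SmoothTensor g) {X Y : VField U}
    (Z : VField U) {x : U} (hX : DiffAt X x) (hY : DiffAt Y x) :
    covDerivTensor (roundCov U) g X Y Z x = covTensor g x (Z x) (X x) (Y x) := by
  rw [covDerivTensor, mvfderiv_tensor_apply hg hX hY]
  ring

theorem height_dincl (x : U) (X : TangentSpace (𝓡 n) x) : height U (dincl x X) x = 0 :=
  inner_incl_dincl x X

theorem mdifferentiableAt_height (v : EuclideanSpace ℝ (Fin (n + 1))) (x : U) :
    MDifferentiableAt (𝓡 n) 𝓘(ℝ) (height U v) x :=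
  (contMDiff_height v).mdifferentiable (by simp) x

/-- The extended round metric is `⟨v, w⟩ - ⟨x, v⟩⟨x, w⟩`. For `v`, `w` tangent at `x` both factors
of the product vanish at `x`, so its derivative does too. -/
theorem covTensor_roundMetric (x : U) : covTensor (roundMetric U) x = 0 := by
  ext Z X Y
  rw [covTensor_apply, mvfderiv_ext2_apply smoothTensor_roundMetric]
  simp only [ext2_roundMetric]
  have h1 : MDifferentiableAt (𝓡 n) 𝓘(ℝ)
      (fun y ↦ height U (dincl x X) y * height U (dincl x Y) y) x :=
    (mdifferentiableAt_height _ x).mul (mdifferentiableAt_height _ x)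
  rw [mvfderiv_fun_sub mdifferentiableAt_const h1, mvfderiv_const,
    mvfderiv_fun_mul (mdifferentiableAt_height _ x) (mdifferentiableAt_height _ x),
    height_dincl, height_dincl]
  simp

theorem isLeviCivita_roundCov : IsLeviCivita (roundMetric U) (roundCov U) := by
  refine ⟨torsion_roundCov, fun x X Y Z _ hY hZ ↦ ?_⟩
  rw [mvfderiv_tensor_apply smoothTensor_roundMetric hY hZ, covTensor_roundMetric]
  simp

/-- The Koszul formula, relative to the covariant derivative of the round metric. -/
theorem IsLeviCivita.koszul {g : Tensor2 U} (hg : SmoothTensor g)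
    (hs : ∀ x X Y, g x X Y = g x Y X) {cov : CovariantDerivative (𝓡 n) (EuclideanSpace ℝ (Fin n))
      (fun x : U ↦ TangentSpace (𝓡 n) x)} (hcov : IsLeviCivita g cov) {x : U} {X Y : VField U}
    (hX : DiffAt X x) (hY : DiffAt Y x) (Z : TangentSpace (𝓡 n) x) :
    2 * g x (cov Y x (X x) - roundCov U Y x (X x)) Z =
      covTensor g x (X x) (Y x) Z + covTensor g x (Y x) (X x) Z - covTensor g x Z (X x) (Y x) := by
  obtain ⟨W, hW, rfl⟩ : ∃ W : VField U, DiffAt W x ∧ W x = Z :=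
    ⟨tfield U (dincl x Z), (smoothAt_tfield _ x).diffAt, tfield_dincl x Z⟩
  -- The difference of the two connections is symmetric, as both are torsion free. Compatibility
  -- with `g` then expresses `covTensor` through it, and the usual permutation of three such
  -- identities solves for the difference.
  have hsymm {X Y : VField U} (hX : DiffAt X x) (hY : DiffAt Y x) :
      cov Y x (X x) - roundCov U Y x (X x) = cov X x (Y x) - roundCov U X x (Y x) := by
    have h1 := cov.torsion_eq_zero_iff.1 hcov.1 hX hY
    have h2 := (roundCov U).torsion_eq_zero_iff.1 torsion_roundCov hX hY
    exact sub_eq_sub_iff_sub_eq_sub.1 (h1.trans h2.symm)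
  have hcomp {X Y Z : VField U} (hX : DiffAt X x) (hY : DiffAt Y x) (hZ : DiffAt Z x) :
      covTensor g x (X x) (Y x) (Z x) = g x (cov Y x (X x) - roundCov U Y x (X x)) (Z x) +
        g x (cov Z x (X x) - roundCov U Z x (X x)) (Y x) := by
    have h1 := hcov.2 x X Y Z hX hY hZ
    rw [mvfderiv_tensor_apply hg hY hZ] at h1
    rw [map_sub, map_sub, _root_.sub_apply, _root_.sub_apply,
      hs x (cov Z x (X x)), hs x (roundCov U Z x (X x))]
    linarith
  have a1 := hcomp hX hY hW
  have a2 := hcomp hY hX hW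
  have a3 := hcomp hW hX hY
  rw [← hsymm hX hW, ← hsymm hY hW] at a3
  rw [← hsymm hX hY] at a2
  linarith

end

/-! ### Linear algebra of a trilinear form symmetric in its last two arguments -/

section

section LinearAlgebra

variable {V : Type*} [AddCommGroup V] [Module ℝ V]

/-- The family `e` is orthonormal for the bilinear form `b`. -/
def IsOrthonormal {ι : Type*} [DecidableEq ι] (b : V →ₗ[ℝ] V →ₗ[ℝ] ℝ) (e : ι → V) : Prop :=
  ∀ i j, b (e i) (e j) = if i = j then 1 else 0

/-- The bilinear form `b` is symmetric and positive definite. -/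
structure IsPosDef (b : V →ₗ[ℝ] V →ₗ[ℝ] ℝ) : Prop where
  symm : ∀ x y, b x y = b y x
  pos : ∀ x, x ≠ 0 → 0 < b x x

variable {b : V →ₗ[ℝ] V →ₗ[ℝ] ℝ}

theorem IsOrthonormal.linearIndependent {ι : Type*} [Fintype ι] [DecidableEq ι] {e : ι → V}
    (he : IsOrthonormal b e) : LinearIndependent ℝ e := by
  rw [Fintype.linearIndependent_iff]
  intro c hc i
  have h : b (e i) (∑ j, c j • e j) = 0 := by rw [hc, map_zero]
  simpa [map_sum, he i] using h

theorem IsOrthonormal.sum_eq [FiniteDimensional ℝ V] {m : ℕ} (hm : Module.finrank ℝ V = m)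
    {e : Fin m → V} (he : IsOrthonormal b e) (x : V) : ∑ i, b (e i) x • e i = x := by
  have hs := he.linearIndependent.span_eq_top_of_card_eq_finrank' (by simp [hm])
  have hx : x ∈ Submodule.span ℝ (Set.range e) := hs ▸ Submodule.mem_top
  obtain ⟨c, rfl⟩ := (Submodule.mem_span_range_iff_exists_fun ℝ).1 hx
  refine Finset.sum_congr rfl fun i _ ↦ ?_
  simp [map_sum, he i]

/-- The matrix `b (f j) (e i)` between two orthonormal bases is orthogonal, so the trace does not
depend on the basis. -/
theorem IsOrthonormal.sum_apply_eq [FiniteDimensional ℝ V] {m : ℕ} (hb : IsPosDef b)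
    (hm : Module.finrank ℝ V = m) {e f : Fin m → V} (he : IsOrthonormal b e)
    (hf : IsOrthonormal b f) (T : V →ₗ[ℝ] V →ₗ[ℝ] ℝ) :
    ∑ i, T (e i) (e i) = ∑ i, T (f i) (f i) := by
  have h1 (i) : T (e i) (e i) = ∑ j, ∑ k, b (f j) (e i) * b (f k) (e i) * T (f j) (f k) := by
    conv_lhs => rw [← hf.sum_eq hm (e i)]
    simp only [map_sum, map_smul, LinearMap.sum_apply, LinearMap.smul_apply, smul_eq_mul]
    rw [Finset.sum_comm]
    refine Finset.sum_congr rfl fun j _ ↦ ?_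
    rw [Finset.mul_sum]
    exact Finset.sum_congr rfl fun k _ ↦ by ring
  have h2 (j k) : ∑ i, b (f j) (e i) * b (f k) (e i) = if j = k then 1 else 0 := by
    rw [← hf j k]
    conv_rhs => rw [← he.sum_eq hm (f k)]
    simp only [map_sum, map_smul, smul_eq_mul]
    exact Finset.sum_congr rfl fun i _ ↦ by rw [hb.symm (e i)]; ring
  simp_rw [h1]
  rw [Finset.sum_comm]
  refine Finset.sum_congr rfl fun j _ ↦ ?_
  rw [Finset.sum_comm]
  simp_rw [← Finset.sum_mul, h2]
  simp

/-- The inner product space structure given by a positive definite bilinear form. -/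
abbrev IsPosDef.core (hb : IsPosDef b) : InnerProductSpace.Core ℝ V where
  inner x y := b x y
  conj_inner_symm x y := hb.symm y x
  re_inner_nonneg x := by
    rcases eq_or_ne x 0 with rfl | hx
    · simp
    · exact (hb.pos x hx).le
  add_left x y z := by simp
  smul_left x y r := by simp
  definite x hx := by
    by_contra h
    exact (hb.pos x h).ne' hx

theorem IsPosDef.exists_orthonormal_cons [FiniteDimensional ℝ V] (hb : IsPosDef b) {m : ℕ}
    (hm : Module.finrank ℝ V = m + 1) {x : V} (hx : b x x = 1) :
    ∃ e : Fin m → V, IsOrthonormal b e ∧ ∀ i, b x (e i) = 0 := by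
  let := hb.core.toNormedAddCommGroup
  let : InnerProductSpace ℝ V := InnerProductSpace.ofCore hb.core.toCore
  have hx0 : x ≠ 0 := by rintro rfl; simp at hx
  have : Fact (Module.finrank ℝ V = m + 1) := ⟨hm⟩
  let B := (stdOrthonormalBasis ℝ (ℝ ∙ x)ᗮ).reindex (finCongr
    (Submodule.finrank_orthogonal_span_singleton (n := m) hx0))
  refine ⟨fun i ↦ B i, fun i j ↦ ?_, fun i ↦ ?_⟩
  · exact (orthonormal_iff_ite.1 B.orthonormal) i j
  · exact Submodule.mem_orthogonal_singleton_iff_inner_right.1 (B i).2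

theorem IsOrthonormal.cons {m : ℕ} (hb : IsPosDef b) {x : V} (hx : b x x = 1) {e : Fin m → V}
    (he : IsOrthonormal b e) (hxe : ∀ i, b x (e i) = 0) :
    IsOrthonormal b (Fin.cons x e : Fin (m + 1) → V) := by
  intro i j
  refine Fin.cases ?_ (fun i ↦ ?_) i <;> refine Fin.cases ?_ (fun j ↦ ?_) j
  · simpa using hx
  · simpa [(Fin.succ_ne_zero j).symm] using hxe j
  · simpa [hb.symm _ x] using hxe i
  · simpa using he i j

theorem IsPosDef.exists_orthonormal [FiniteDimensional ℝ V] (hb : IsPosDef b) {m : ℕ}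
    (hm : Module.finrank ℝ V = m) : ∃ e : Fin m → V, IsOrthonormal b e := by
  let := hb.core.toNormedAddCommGroup
  let : InnerProductSpace ℝ V := InnerProductSpace.ofCore hb.core.toCore
  let B := (stdOrthonormalBasis ℝ V).reindex (finCongr hm)
  exact ⟨fun i ↦ B i, fun i j ↦ (orthonormal_iff_ite.1 B.orthonormal) i j⟩

variable {D : V →ₗ[ℝ] V →ₗ[ℝ] V →ₗ[ℝ] ℝ}

/-- Polarisation of a cubic form. The same lemma with `θ = 0` turns vanishing on the diagonal into
the Killing equation. -/
theorem cyclic_sum_eq_of_diag (hb : IsPosDef b) (hD : ∀ x y z, D x y z = D x z y)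
    {θ : V →ₗ[ℝ] ℝ} (h : ∀ x, D x x x = θ x * b x x) (x y z : V) :
    D x y z + D y z x + D z x y = θ x * b y z + θ y * b z x + θ z * b x y := by
  have h1 := h (x + y + z)
  have h2 := h (x + y)
  have h3 := h (y + z)
  have h4 := h (x + z)
  have h5 := h x
  have h6 := h y
  have h7 := h z
  simp only [map_add, LinearMap.add_apply] at h1 h2 h3 h4
  simp only [hD x z y, hD y x z, hD z y x, hD x y x, hD x z x, hD y x y, hD y z y, hD z x z,
    hD z y z, hb.symm y x, hb.symm z x, hb.symm z y] at h1 h2 h3 h4 ⊢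
  -- Inclusion-exclusion isolates the terms trilinear in `x`, `y`, `z`; by symmetry each occurs
  -- twice.
  linear_combination (h1 - h2 - h3 - h4 + h5 + h6 + h7) / 2

/-- The bilinear form whose trace on a hyperplane orthogonal to `x` is twice the mean curvature
in the direction `x`. -/
def curvForm (D : V →ₗ[ℝ] V →ₗ[ℝ] V →ₗ[ℝ] ℝ) (x : V) : V →ₗ[ℝ] V →ₗ[ℝ] ℝ :=
  (2 : ℝ) • D.compr₂ (LinearMap.applyₗ x) - D x

theorem curvForm_apply (x y z : V) : curvForm D x y z = 2 * D y z x - D x y z := by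
  simp [curvForm]

variable [FiniteDimensional ℝ V] {m : ℕ}

/-- Complete `e` to an orthonormal basis by the normalisation of `x`: the extra diagonal entry is `D
x x x / b x x`, because `curvForm D x x x = D x x x`. Multiplying by `b x x` avoids the division. -/
theorem sum_curvForm (hb : IsPosDef b) (hm : Module.finrank ℝ V = m + 1)
    {f : Fin (m + 1) → V} (hf : IsOrthonormal b f) {x : V} {e : Fin m → V}
    (he : IsOrthonormal b e) (hxe : ∀ i, b x (e i) = 0) :
    b x x * ∑ i, curvForm D x (f i) (f i) = D x x x + b x x * ∑ i, curvForm D x (e i) (e i) := by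
  rcases eq_or_ne x 0 with rfl | hx
  · simp
  have h0 := hb.pos x hx
  set c := √(b x x)
  have hc : c * c = b x x := Real.mul_self_sqrt h0.le
  have hc0 : c ≠ 0 := (Real.sqrt_pos.2 h0).ne'
  have h1 : b (c⁻¹ • x) (c⁻¹ • x) = 1 := by
    simp only [map_smul, LinearMap.smul_apply, smul_eq_mul, ← hc]
    field_simp
  have h2 := he.cons hb h1 (fun i ↦ by simp [hxe i])
  rw [hf.sum_apply_eq hb hm h2, Fin.sum_univ_succ]
  simp only [Fin.cons_zero, Fin.cons_succ, mul_add]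
  congr 1
  rw [curvForm_apply]
  simp only [map_smul, LinearMap.smul_apply, smul_eq_mul, ← hc]
  field_simp
  ring

/-- Trace of the polarised identity over its last two arguments. The constant `m + 3` is the
dimension `m + 1`, from the trace of `b`, plus one from each of the other two terms. -/
theorem sum_add_sum_eq_of_diag (hb : IsPosDef b) (hD : ∀ x y z, D x y z = D x z y)
    (hm : Module.finrank ℝ V = m + 1) {f : Fin (m + 1) → V} (hf : IsOrthonormal b f)
    {θ : V →ₗ[ℝ] ℝ} (h : ∀ x, D x x x = θ x * b x x) (x : V) :
    ∑ i, D x (f i) (f i) + 2 * ∑ i, D (f i) (f i) x = (m + 3) * θ x := by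
  have h2 := cyclic_sum_eq_of_diag hb hD h
  have h4 : ∑ i, (D x (f i) (f i) + D (f i) (f i) x + D (f i) x (f i)) =
      ∑ i, (θ x * b (f i) (f i) + θ (f i) * b (f i) x + θ (f i) * b x (f i)) :=
    Finset.sum_congr rfl fun i _ ↦ h2 x (f i) (f i)
  have h5 : ∑ i, θ (f i) * b (f i) x = θ x := by
    conv_rhs => rw [← hf.sum_eq hm x]
    simp [mul_comm]
  have h6 : ∑ i, θ (f i) * b x (f i) = θ x := by
    rw [← h5]; exact Finset.sum_congr rfl fun i _ ↦ by rw [hb.symm x]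
  have h7 : ∑ i, θ x * b (f i) (f i) = (m + 1) * θ x := by
    simp [hf _ _]
  have h8 : ∑ i, D (f i) x (f i) = ∑ i, D (f i) (f i) x :=
    Finset.sum_congr rfl fun i _ ↦ hD _ _ _
  rw [Finset.sum_add_distrib, Finset.sum_add_distrib, Finset.sum_add_distrib,
    Finset.sum_add_distrib, h5, h6, h7, h8] at h4
  linarith

/-- If the traces over hyperplanes vanish, `sum_curvForm` says that `D x x x = θ x * b x x` with `θ`
the full trace of `curvForm`. Substituting `θ x = 2 ∑ D (f i) (f i) x - ∑ D x (f i) (f i)` into the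
traced polarisation determines `θ`. -/
theorem diag_eq_of_sum_curvForm_eq_zero (hb : IsPosDef b) (hD : ∀ x y z, D x y z = D x z y)
    (hm : Module.finrank ℝ V = m + 1)
    (H : ∀ (x : V) (e : Fin m → V), x ≠ 0 → IsOrthonormal b e → (∀ i, b x (e i) = 0) →
      ∑ i, curvForm D x (e i) (e i) = 0)
    {f : Fin (m + 1) → V} (hf : IsOrthonormal b f) (x : V) :
    D x x x = (2 / (m + 2) * ∑ i, D x (f i) (f i)) * b x x := by
  let θ : V →ₗ[ℝ] ℝ := ∑ i, ((2 : ℝ) • D (f i) (f i) - (D.flip (f i)).flip (f i))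
  have hθ (x) : θ x = ∑ i, curvForm D x (f i) (f i) := by
    simp [θ, curvForm_apply]
  have h1 (x) : D x x x = θ x * b x x := by
    rcases eq_or_ne x 0 with rfl | hx
    · simp
    have h0 := hb.pos x hx
    obtain ⟨e, he, hxe⟩ := hb.exists_orthonormal_cons hm (x := (√(b x x))⁻¹ • x) (by
      have hc : √(b x x) * √(b x x) = b x x := Real.mul_self_sqrt h0.le
      have hc0 : √(b x x) ≠ 0 := (Real.sqrt_pos.2 h0).ne'
      simp only [map_smul, LinearMap.smul_apply, smul_eq_mul]
      field_simp
      rw [sq, hc])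
    have hxe' (i) : b x (e i) = 0 := by
      have := hxe i
      rw [map_smul, LinearMap.smul_apply, smul_eq_mul, mul_eq_zero] at this
      exact this.resolve_left (inv_ne_zero (Real.sqrt_pos.2 h0).ne')
    have h2 := sum_curvForm (D := D) hb hm hf he hxe'
    rw [H x e hx he hxe', ← hθ] at h2
    linarith
  have h3 : θ x = 2 / (m + 2) * ∑ i, D x (f i) (f i) := by
    have h4 := sum_add_sum_eq_of_diag hb hD hm hf h1 x
    have h9 : θ x = 2 * ∑ i, D (f i) (f i) x - ∑ i, D x (f i) (f i) := by
      rw [hθ]; simp [curvForm_apply, Finset.mul_sum]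
    have h10 : (m : ℝ) + 2 ≠ 0 := by positivity
    field_simp
    linarith
  rw [h1, h3]

/-- The converse: the trace hypothesis on `θ` makes the full trace of `curvForm` equal to `θ x`,
which `sum_curvForm` cancels against `D x x x`. -/
theorem sum_curvForm_eq_zero (hb : IsPosDef b) (hD : ∀ x y z, D x y z = D x z y)
    (hm : Module.finrank ℝ V = m + 1) {f : Fin (m + 1) → V} (hf : IsOrthonormal b f)
    {θ : V →ₗ[ℝ] ℝ} (h : ∀ x, D x x x = θ x * b x x)
    (hθ : ∀ x, ∑ i, D x (f i) (f i) = (m + 2) / 2 * θ x) {x : V} {e : Fin m → V}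
    (he : IsOrthonormal b e) (hxe : ∀ i, b x (e i) = 0) :
    ∑ i, curvForm D x (e i) (e i) = 0 := by
  rcases eq_or_ne x 0 with rfl | hx
  · simp [curvForm_apply]
  have h0 := hb.pos x hx
  have h3 := sum_curvForm (D := D) hb hm hf he hxe
  have h4 := sum_add_sum_eq_of_diag hb hD hm hf h x
  have h9 : ∑ i, curvForm D x (f i) (f i) = 2 * ∑ i, D (f i) (f i) x - ∑ i, D x (f i) (f i) := by
    simp [curvForm_apply, Finset.mul_sum]
  have h11 : ∑ i, curvForm D x (f i) (f i) = θ x := by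
    rw [h9]
    have := hθ x
    linarith
  rw [h11, h] at h3
  have : b x x * ∑ i, curvForm D x (e i) (e i) = 0 := by linarith
  exact (mul_eq_zero.1 this).resolve_left h0.ne'

end LinearAlgebra

end

/-! ### Existence of the Levi-Civita connection; mean curvature of equators -/

section

theorem IsPosDef.exists_apply_eq {V : Type*} [AddCommGroup V] [Module ℝ V] [FiniteDimensional ℝ V]
    {b : V →ₗ[ℝ] V →ₗ[ℝ] ℝ} (hb : IsPosDef b) (K : V →ₗ[ℝ] V →ₗ[ℝ] V →ₗ[ℝ] ℝ) :
    ∃ A : V →ₗ[ℝ] V →ₗ[ℝ] V, ∀ x y z, b (A x y) z = K x y z := by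
  have hinj : Function.Injective b := by
    refine (injective_iff_map_eq_zero b).2 fun x hx ↦ ?_
    by_contra h
    exact (hb.pos x h).ne' (by rw [hx]; rfl)
  let e : V ≃ₗ[ℝ] Module.Dual ℝ V :=
    LinearMap.linearEquivOfInjective b hinj Subspace.dual_finrank_eq.symm
  refine ⟨K.compr₂ (e.symm : Module.Dual ℝ V →ₗ[ℝ] V), fun x y z ↦ ?_⟩
  exact congr($(e.apply_symm_apply (K x y)) z)

theorem IsPosDef.exists_koszul {V : Type*} [AddCommGroup V] [Module ℝ V] [FiniteDimensional ℝ V]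
    {b : V →ₗ[ℝ] V →ₗ[ℝ] ℝ} (hb : IsPosDef b) (D : V →ₗ[ℝ] V →ₗ[ℝ] V →ₗ[ℝ] ℝ) :
    ∃ A : V →ₗ[ℝ] V →ₗ[ℝ] V, ∀ x y z,
      b (A x y) z = (1 / 2) * (D x y z + D y x z - D z x y) := by
  let K : V →ₗ[ℝ] V →ₗ[ℝ] V →ₗ[ℝ] ℝ := LinearMap.mk₂ ℝ
    (fun x y ↦ (1 / 2 : ℝ) • (D x y + D y x - (D.flip x).flip y))
    (fun _ _ _ ↦ by ext; simp; ring) (fun _ _ _ ↦ by ext; simp; ring)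
    (fun _ _ _ ↦ by ext; simp; ring) (fun _ _ _ ↦ by ext; simp; ring)
  obtain ⟨A, hA⟩ := hb.exists_apply_eq K
  exact ⟨A, fun x y z ↦ by rw [hA]; simp [K]⟩

variable {n : ℕ} {U : Opens (Sph n)}

instance instT2SpaceTangentSpace (x : U) : T2Space (TangentSpace (𝓡 n) x) :=
  inferInstanceAs (T2Space (EuclideanSpace ℝ (Fin n)))

/-- A two-tensor at a point, as a bilinear form. -/
def bilinAt (g : Tensor2 U) (x : U) :
    TangentSpace (𝓡 n) x →ₗ[ℝ] TangentSpace (𝓡 n) x →ₗ[ℝ] ℝ :=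
  LinearMap.mk₂ ℝ (fun X Y ↦ g x X Y) (fun _ _ _ ↦ by simp) (fun _ _ _ ↦ by simp)
    (fun _ _ _ ↦ by simp) (fun _ _ _ ↦ by simp)

theorem bilinAt_apply (g : Tensor2 U) (x : U) (X Y : TangentSpace (𝓡 n) x) :
    bilinAt g x X Y = g x X Y := rfl

theorem isPosDef_bilinAt (g : PosTensor U) (x : U) : IsPosDef (bilinAt g.inner x) :=
  ⟨g.symm x, g.pos x⟩

/-- Minimality, as defined, includes the existence of a connection. It is the round connection plus
the tensor `A` that solves the Koszul formula; the symmetry of `A` gives zero torsion. -/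
theorem exists_isLeviCivita (g : PosTensor U) :
    ∃ cov : CovariantDerivative (𝓡 n) (EuclideanSpace ℝ (Fin n))
      (fun x : U ↦ TangentSpace (𝓡 n) x), IsLeviCivita g.inner cov := by
  have hg := smoothTensor_inner g
  choose A hA using fun x ↦ (isPosDef_bilinAt g x).exists_koszul (covTensor g.inner x)
  have hA' (x : U) (X Y Z) : g.inner x (A x X Y) Z = (1 / 2) * (covTensor g.inner x X Y Z +
      covTensor g.inner x Y X Z - covTensor g.inner x Z X Y) := hA x X Y Z
  have hsymm (x : U) (X Y) : A x X Y = A x Y X := by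
    by_contra h
    refine (g.pos x _ (sub_ne_zero.2 h)).ne' ?_
    set W := A x X Y - A x Y X
    have h1 : g.inner x W W = g.inner x (A x X Y) W - g.inner x (A x Y X) W := by
      conv_lhs => enter [1]; rw [show W = A x X Y - A x Y X from rfl, map_sub]
      rfl
    rw [h1, hA', hA', covTensor_symm hg g.symm x W X Y]
    ring
  let Ac (x : U) : TangentSpace (𝓡 n) x →L[ℝ] TangentSpace (𝓡 n) x →L[ℝ] TangentSpace (𝓡 n) x :=
    LinearMap.toContinuousLinearMap
      ((LinearMap.toContinuousLinearMap : (TangentSpace (𝓡 n) x →ₗ[ℝ] TangentSpace (𝓡 n) x) ≃ₗ[ℝ] _)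
        ∘ₗ A x)
  refine ⟨(roundCov U).addOneForm Ac, ?_, fun x X Y Z hX hY hZ ↦ ?_⟩
  · rw [CovariantDerivative.torsion_eq_zero_iff]
    intro X Y x hX hY
    have h := (roundCov U).torsion_eq_zero_iff.1 torsion_roundCov hX hY
    change (roundCov U Y x (X x) + A x (Y x) (X x)) - (roundCov U X x (Y x) + A x (X x) (Y x)) = _
    rw [← h, hsymm x (X x)]
    abel
  · rw [mvfderiv_tensor_apply hg hY hZ]
    change _ = g.inner x (roundCov U Y x (X x) + A x (Y x) (X x)) (Z x) +
      g.inner x (Y x) (roundCov U Z x (X x) + A x (Z x) (X x))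
    have h1 := congr($((g.inner x).map_add (roundCov U Y x (X x)) (A x (Y x) (X x))) (Z x))
    have h2 := (g.inner x (Y x)).map_add (roundCov U Z x (X x)) (A x (Z x) (X x))
    refine Eq.trans ?_ (congrArg₂ (· + ·) h1 h2).symm
    change _ = (g.inner x (roundCov U Y x (X x)) (Z x) + g.inner x (A x (Y x) (X x)) (Z x)) + _
    have h3 := g.symm x (Y x) (A x (Z x) (X x))
    have h4 := hA' x (Y x) (X x) (Z x)
    have h5 := hA' x (Z x) (X x) (Y x)
    have h6 := covTensor_symm hg g.symm x (X x) (Z x) (Y x)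
    have h7 := covTensor_symm hg g.symm x (Y x) (Z x) (X x)
    have h8 := covTensor_symm hg g.symm x (Z x) (Y x) (X x)
    linarith

theorem mvfderiv_height (v : EuclideanSpace ℝ (Fin (n + 1))) (x : U) (X : TangentSpace (𝓡 n) x) :
    mvfderiv (𝓡 n) (height U v) x X = ⟪dincl x X, v⟫_ℝ := by
  have e : height U v = fun y ↦ innerSL ℝ v (incl U y) := by
    ext y; rw [height, real_inner_comm, innerSL_apply_apply]
  rw [e, mvfderiv_clm_comp _ (contMDiff_incl.mdifferentiable (by simp) x), innerSL_apply_apply,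
    real_inner_comm]

/-- A differentiable function vanishing on an equator is stationary along the equator. -/
theorem mvfderiv_eq_zero_of_eventually {h : U → ℝ} {p : U} (hh : MDifferentiableAt (𝓡 n) 𝓘(ℝ) h p)
    {v : (EuclideanSpace ℝ (Fin (n + 1)))} (hp : height U v p = 0) (hz : ∀ᶠ q in 𝓝 p,
        height U v q = 0 → h q = 0)
    {X : TangentSpace (𝓡 n) p} (hX : mvfderiv (𝓡 n) (height U v) p X = 0) :
    mvfderiv (𝓡 n) h p X = 0 := by
  set w : (EuclideanSpace ℝ (Fin (n + 1))) := dincl p X with hw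
  have hpw : ⟪incl U p, w⟫_ℝ = 0 := inner_incl_dincl p X
  have hwv : ⟪w, v⟫_ℝ = 0 := by rw [mvfderiv_height] at hX; exact hX
  have hpos (t : ℝ) : 0 < 1 + t ^ 2 * ‖w‖ ^ 2 := by positivity
  -- The line `p + t w` projected radially to the sphere: a curve in the equator `v^⊥` with velocity
  -- `w` at `p`.
  let c : ℝ → (EuclideanSpace ℝ (Fin (n + 1))) := fun t ↦ (√(1 + t ^ 2 * ‖w‖ ^ 2))⁻¹ •
      (incl U p + t • w)
  have hcs (t : ℝ) : c t ∈ Metric.sphere (0 : EuclideanSpace ℝ (Fin (n + 1))) 1 := by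
    have h1 : ‖incl U p + t • w‖ = √(1 + t ^ 2 * ‖w‖ ^ 2) := by
      rw [eq_comm, Real.sqrt_eq_iff_mul_self_eq (hpos t).le (norm_nonneg _), ← sq, norm_add_sq_real,
        norm_incl, norm_smul, inner_smul_right, hpw, mul_pow, Real.norm_eq_abs, sq_abs]
      ring
    rw [mem_sphere_zero_iff_norm, norm_smul, h1, norm_inv, Real.norm_eq_abs,
      abs_of_pos (Real.sqrt_pos.2 (hpos t)), inv_mul_cancel₀ (Real.sqrt_pos.2 (hpos t)).ne']
  have hcsm : ContMDiff 𝓘(ℝ) 𝓘(ℝ, EuclideanSpace ℝ (Fin (n + 1))) ∞ c := by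
    refine ContDiff.contMDiff (ContDiff.smul (ContDiff.inv (ContDiff.sqrt ?_ fun t ↦ (hpos t).ne')
      fun t ↦ (Real.sqrt_pos.2 (hpos t)).ne') ?_) <;> fun_prop
  have hcd : HasDerivAt c w 0 := by
    have h1 : HasDerivAt (fun t : ℝ ↦ 1 + t ^ 2 * ‖w‖ ^ 2) 0 0 := by
      simpa using (((hasDerivAt_id (0 : ℝ)).pow 2).mul_const (‖w‖ ^ 2)).const_add 1
    have h2 := (h1.sqrt (hpos 0).ne').inv (Real.sqrt_pos.2 (hpos 0)).ne'
    have h3 : HasDerivAt (fun t : ℝ ↦ incl U p + t • w) w 0 := by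
      simpa using ((hasDerivAt_id (0 : ℝ)).smul_const w).const_add (incl U p)
    have h4 := h2.smul h3
    exact h4.congr_deriv (by simp)
  have hcv (t : ℝ) : ⟪c t, v⟫_ℝ = 0 := by
    rw [inner_smul_left, inner_add_left, inner_smul_left, hwv, show ⟪incl U p, v⟫_ℝ = 0 from hp]
    simp
  have hc0 : c 0 = incl U p := by simp [c]
  let cs : ℝ → Sph n := Set.codRestrict c _ hcs
  have hcs0 : cs 0 = (p : Sph n) := Subtype.ext hc0
  have hcssm : ContMDiff 𝓘(ℝ) (𝓡 n) ∞ cs := hcsm.codRestrict_sphere hcs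
  let γ : ℝ → U := toOpens p ∘ cs
  have hγ0 : γ 0 = p := by simp only [γ, Function.comp_apply, hcs0, toOpens_val]
  have hγ : MDifferentiableAt 𝓘(ℝ) (𝓡 n) γ 0 := by
    have h1 : ContMDiffAt (𝓡 n) (𝓡 n) ∞ (toOpens p) (cs 0) := by
      rw [hcs0]; exact contMDiffAt_toOpens p p
    exact (h1.comp 0 (hcssm 0)).mdifferentiableAt (by simp)
  have hin : ∀ᶠ t in 𝓝 (0 : ℝ), cs t ∈ U :=
    hcssm.continuous.continuousAt.eventually_mem (by rw [hcs0]; exact U.isOpen.mem_nhds p.2)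
  have hγc : ∀ᶠ t in 𝓝 (0 : ℝ), incl U (γ t) = c t := by
    filter_upwards [hin] with t ht
    exact congrArg Subtype.val (val_toOpens p ht)
  have hd : mvfderiv 𝓘(ℝ) (incl U ∘ γ) 0 (1 : ℝ) = w := by
    have h1 : incl U ∘ γ =ᶠ[𝓝 0] c := hγc
    rw [mvfderiv_congr h1]
    have h2 : mfderiv 𝓘(ℝ) 𝓘(ℝ, EuclideanSpace ℝ (Fin (n + 1))) c 0 = fderiv ℝ c 0 :=
        mfderiv_eq_fderiv
    have h3 : fderiv ℝ c 0 1 = w := by rw [hcd.hasFDerivAt.fderiv]; simp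
    exact congr($h2 (1 : ℝ)).trans h3
  have hvel : mfderiv 𝓘(ℝ) (𝓡 n) γ 0 (1 : ℝ) = X := by
    have h1 := mfderiv_comp_of_eq (x := (0 : ℝ)) (y := p)
      (contMDiff_incl.mdifferentiable (by simp) p) hγ hγ0
    rw [hγ0] at h1
    have h2 := congr($h1 (1 : ℝ))
    exact dincl_injective p (h2.symm.trans hd)
  have hhγ : h ∘ γ =ᶠ[𝓝 0] fun _ ↦ (0 : ℝ) := by
    have h1 := (hγ.continuousAt.tendsto.eventually (by rw [hγ0]; exact hz))
    filter_upwards [h1, hγc] with t h2 h3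
    exact h2 (by rw [height, h3, hcv])
  have h1 := mfderiv_comp_of_eq (x := (0 : ℝ)) (y := p) hh hγ hγ0
  rw [hhγ.mfderiv_eq, mfderiv_const, hγ0] at h1
  have h2 := congr($h1 (1 : ℝ))
  exact (congrArg (mfderiv (𝓡 n) 𝓘(ℝ) h p) hvel.symm).trans h2.symm

/-- The equators are totally geodesic. -/
theorem inner_dincl_roundCov_eq_zero {v : (EuclideanSpace ℝ (Fin (n + 1)))} {p : U} (hp :
    height U v p = 0) {Y : VField U}
    (hY : DiffAt Y p)
    (ht : ∀ᶠ q in 𝓝 p, height U v q = 0 → mvfderiv (𝓡 n) (height U v) q (Y q) = 0)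
    {X : TangentSpace (𝓡 n) p} (hX : mvfderiv (𝓡 n) (height U v) p X = 0) :
    ⟪dincl p (roundCov U Y p X), v⟫_ℝ = 0 := by
  have h1 : MDifferentiableAt (𝓡 n) 𝓘(ℝ) (fun y ↦ innerSL ℝ v (dincl y (Y y))) p :=
    mdifferentiableAt_const.clm_apply hY.dincl
  have h2 := mvfderiv_eq_zero_of_eventually h1 hp (ht.mono fun q h hq ↦ by
    rw [innerSL_apply_apply, real_inner_comm, ← mvfderiv_height]; exact h hq) hX
  rw [mvfderiv_clm_comp _ hY.dincl, innerSL_apply_apply] at h2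
  rw [roundCov_apply, dincl_toTangent, tproj_apply, inner_sub_left, inner_smul_left,
    show ⟪incl U p, v⟫_ℝ = 0 from hp, real_inner_comm, h2]
  simp

theorem IsLeviCivita.sum_curvForm_eq {g : Tensor2 U} (hg : SmoothTensor g)
    (hs : ∀ x X Y, g x X Y = g x Y X) {cov : CovariantDerivative (𝓡 n) (EuclideanSpace ℝ (Fin n))
      (fun x : U ↦ TangentSpace (𝓡 n) x)} (hcov : IsLeviCivita g cov) {p : U} {ι : Type*}
          [Fintype ι]
    {E : ι → VField U} (hE : ∀ i, DiffAt (E i) p) (ν : TangentSpace (𝓡 n) p)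
    (h0 : ∀ i, g p (roundCov U (E i) p (E i p)) ν = 0) :
    ∑ i, curvForm (covTensor g p) ν (E i p) (E i p) = 2 * ∑ i, g p (cov (E i) p (E i p)) ν := by
  rw [Finset.mul_sum]
  refine Finset.sum_congr rfl fun i _ ↦ ?_
  have h1 := hcov.koszul hg hs (hE i) (hE i) ν
  have h2 := congr($((g p).map_sub (cov (E i) p (E i p)) (roundCov U (E i) p (E i p))) ν)
  have h3 : g p (cov (E i) p (E i p) - roundCov U (E i) p (E i p)) ν =
    g p (cov (E i) p (E i p)) ν - g p (roundCov U (E i) p (E i p)) ν := h2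
  rw [curvForm_apply]
  linarith [h0 i]

/-- The field is `w - ⟨y, w⟩ y` with `⟨p, w⟩ = 0`, so its derivative at `p` is a multiple of the
normal vector `p`. Hence these extensions are parallel at `p`. -/
theorem roundCov_tfield_dincl (p : U) (X Y : TangentSpace (𝓡 n) p) :
    roundCov U (tfield U (dincl p X)) p Y = 0 := by
  set w : (EuclideanSpace ℝ (Fin (n + 1))) := dincl p X with hw
  have hs : MDifferentiableAt (𝓡 n) 𝓘(ℝ, EuclideanSpace ℝ (Fin (n + 1)))
      (fun y ↦ height U w y • incl U y) p :=
    (mdifferentiableAt_height w p).smul (contMDiff_incl.mdifferentiable (by simp) p)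
  have hp : height U w p = 0 := height_dincl p X
  rw [roundCov_apply]
  simp only [tfield, dincl_toTangent, tproj_apply]
  change toTangent p (mvfderiv (𝓡 n) (fun y ↦ w - height U w y • incl U y) p Y) = 0
  rw [mvfderiv_fun_sub mdifferentiableAt_const hs, mvfderiv_const,
    mvfderiv_fun_smul (mdifferentiableAt_height w p) (contMDiff_incl.mdifferentiable (by simp) p),
        hp]
  have h1 : toTangent p ((-mvfderiv (𝓡 n) (height U w) p Y) • incl U p) = 0 := by
    rw [map_smul, toTangent_incl, smul_zero]
  refine Eq.trans ?_ h1
  congr 1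
  simp

/-- The equators are minimal if and only if the trace of `curvForm` vanishes on every hyperplane. -/
theorem hasMinimalEquators_iff (g : PosTensor U) : HasMinimalEquators g.inner ↔
    ∀ (p : U) (x : TangentSpace (𝓡 n) p) (e : Fin (n - 1) → TangentSpace (𝓡 n) p), x ≠ 0 →
      IsOrthonormal (bilinAt g.inner p) e → (∀ i, bilinAt g.inner p x (e i) = 0) →
        ∑ i, curvForm (covTensor g.inner p) x (e i) (e i) = 0 := by
  have hg := smoothTensor_inner g
  constructor
  · intro H p x e hx he hxe
    -- The vector `v` represents the covector `g(x, ·)` extended by zero to the normal direction.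
    -- Its equator therefore passes through `p`, and its tangent space there is the `g`-orthogonal
    -- complement of `x`.
    let v : (EuclideanSpace ℝ (Fin (n + 1))) := (InnerProductSpace.toDual ℝ (EuclideanSpace ℝ (Fin
        (n + 1)))).symm ((g.inner p x).comp (toTangent p))
    have hv (w : EuclideanSpace ℝ (Fin (n + 1))) : ⟪w, v⟫_ℝ = g.inner p x (toTangent p w) := by
      rw [real_inner_comm, InnerProductSpace.toDual_symm_apply]; rfl
    have hvX (w : TangentSpace (𝓡 n) p) : ⟪dincl p w, v⟫_ℝ = g.inner p x w := by
      rw [hv, toTangent_dincl]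
    have hp : height U v p = 0 := by
      rw [height, hv, toTangent_incl]; exact (g.inner p x).map_zero
    have hv0 : v ≠ 0 := by
      intro h
      refine (g.pos p x hx).ne' ?_
      rw [← hvX, h, inner_zero_right]
    obtain ⟨cov, hcov, hm⟩ := H v hv0
    have hE (i) : SmoothAt (tfield U (dincl p (e i))) p := smoothAt_tfield _ p
    have h1 := hm p hp (fun i ↦ tfield U (dincl p (e i))) hE
      -- At a point `q` of the equator, `⟨e_i - ⟨q, e_i⟩ q, v⟩ = ⟨e_i, v⟩ = g(x, e_i) = 0`.
      (fun i ↦ Filter.Eventually.of_forall fun q hq ↦ by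
        rw [mvfderiv_height, tfield, dincl_toTangent, tproj_apply, inner_sub_left, inner_smul_left,
          show ⟪incl U q, v⟫_ℝ = 0 from hq, hvX]
        have := hxe i
        rw [bilinAt_apply] at this
        simp [this])
      (fun i j ↦ by rw [tfield_dincl, tfield_dincl]; exact he i j) x
      (fun w hw ↦ by rw [← hvX, ← mvfderiv_height]; exact hw)
    have h2 := hcov.sum_curvForm_eq hg g.symm (fun i ↦ (hE i).diffAt) x
      (fun i ↦ by
        rw [roundCov_tfield_dincl]
        exact congr($((g.inner p).map_zero) x))
    rw [h1, mul_zero] at h2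
    simpa only [tfield_dincl] using h2
  · intro H v hv
    obtain ⟨cov, hcov⟩ := exists_isLeviCivita g
    refine ⟨cov, hcov, fun p hp E hE ht hon ν hν ↦ ?_⟩
    rcases eq_or_ne ν 0 with rfl | hν0
    · exact Finset.sum_eq_zero fun i _ ↦ (g.inner p _).map_zero
    have ht' (i) : mvfderiv (𝓡 n) (height U v) p (E i p) = 0 := (ht i).self_of_nhds hp
    have h1 := H p ν (fun i ↦ E i p) hν0 hon fun i ↦ hν _ (ht' i)
    have h2 := hcov.sum_curvForm_eq hg g.symm (fun i ↦ (hE i).diffAt) ν fun i ↦ by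
      rw [g.symm]
      refine hν _ ?_
      rw [mvfderiv_height]
      exact inner_dincl_roundCov_eq_zero hp (hE i).diffAt (ht i) (ht' i)
    linarith

end

/-! ### Gram determinants and volume factors -/

section

section Gram

variable {V : Type*} [AddCommGroup V] [Module ℝ V] {n : ℕ}

/-- The Gram determinant of `v` for the bilinear form `b`. -/
def gramDet (b : V →ₗ[ℝ] V →ₗ[ℝ] ℝ) (v : Fin n → V) : ℝ :=
  (Matrix.of fun i j ↦ b (v i) (v j)).det

variable {b c : V →ₗ[ℝ] V →ₗ[ℝ] ℝ}

theorem IsOrthonormal.gramDet_eq_one {e : Fin n → V} (he : IsOrthonormal b e) :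
    gramDet b e = 1 := by
  have : (Matrix.of fun i j ↦ b (e i) (e j)) = 1 := by
    ext i j; simp [he i j, Matrix.one_apply]
  rw [gramDet, this, Matrix.det_one]

variable [FiniteDimensional ℝ V]

theorem IsOrthonormal.gramDet_eq (hn : Module.finrank ℝ V = n) {e : Fin n → V}
    (he : IsOrthonormal c e) (b : V →ₗ[ℝ] V →ₗ[ℝ] ℝ) (v : Fin n → V) :
    gramDet b v = (Matrix.of fun i j ↦ c (e i) (v j)).det ^ 2 * gramDet b e := by
  set M := Matrix.of fun i j ↦ c (e i) (v j) with hM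
  have h : (Matrix.of fun i j ↦ b (v i) (v j)) =
      M.transpose * (Matrix.of fun i j ↦ b (e i) (e j)) * M := by
    ext i j
    rw [Matrix.of_apply]
    conv_lhs => rw [← he.sum_eq hn (v i), ← he.sum_eq hn (v j)]
    simp only [map_sum, map_smul, LinearMap.sum_apply, LinearMap.smul_apply, smul_eq_mul,
      Matrix.mul_apply, Matrix.transpose_apply, Matrix.of_apply, hM, Finset.sum_mul, Finset.mul_sum]
    exact Finset.sum_congr rfl fun k _ ↦ Finset.sum_congr rfl fun l _ ↦ by ring
  rw [gramDet, h, Matrix.det_mul, Matrix.det_mul, Matrix.det_transpose, gramDet]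
  ring

theorem IsPosDef.gramDet_nonneg (hb : IsPosDef b) (hn : Module.finrank ℝ V = n) (v : Fin n → V) :
    0 ≤ gramDet b v := by
  obtain ⟨e, he⟩ := hb.exists_orthonormal hn
  rw [he.gramDet_eq hn, he.gramDet_eq_one]
  positivity

theorem IsPosDef.gramDet_pos (hb : IsPosDef b) (hn : Module.finrank ℝ V = n) {e : Fin n → V}
    (he : IsOrthonormal c e) : 0 < gramDet b e := by
  refine (hb.gramDet_nonneg hn e).lt_of_ne' fun h ↦ ?_
  obtain ⟨f, hf⟩ := hb.exists_orthonormal hn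
  have h1 := he.gramDet_eq hn b f
  rw [hf.gramDet_eq_one, h, mul_zero] at h1
  exact one_ne_zero h1

theorem IsPosDef.exists_gramDet_eq_mul (hb : IsPosDef b) (hc : IsPosDef c)
    (hn : Module.finrank ℝ V = n) :
    ∃ ρ > 0, ∀ v : Fin n → V, gramDet b v = ρ * gramDet c v := by
  obtain ⟨e, he⟩ := hc.exists_orthonormal hn
  refine ⟨gramDet b e, hb.gramDet_pos hn he, fun v ↦ ?_⟩
  rw [he.gramDet_eq hn b, he.gramDet_eq hn c, he.gramDet_eq_one]
  ring

end Gram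

section Det

/-- The determinant, as a continuous multilinear map of the rows. -/
def detMap (m : ℕ) : ContinuousMultilinearMap ℝ (fun _ : Fin m ↦ Fin m → ℝ) ℝ where
  toMultilinearMap := (Matrix.detRowAlternating (n := Fin m) (R := ℝ)).toMultilinearMap
  cont := Continuous.matrix_det (n := Fin m) (R := ℝ) continuous_id

/-- Jacobi's formula at the identity: the determinant with row `i` replaced by `B i` is a Cramer
coordinate, here `B i i`. -/
theorem linearDeriv_detMap_one {m : ℕ} (B : Fin m → Fin m → ℝ) :
    (detMap m).linearDeriv (fun i j ↦ if i = j then 1 else 0) B = ∑ i, B i i := by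
  rw [ContinuousMultilinearMap.linearDeriv_apply]
  refine Finset.sum_congr rfl fun i _ ↦ ?_
  have h1 : (fun i j ↦ if i = j then 1 else 0) = (1 : Matrix (Fin m) (Fin m) ℝ) := by
    ext i j; exact Matrix.one_apply.symm
  rw [h1]
  refine (Matrix.cramer_transpose_apply (1 : Matrix (Fin m) (Fin m) ℝ) (B i) i).symm.trans ?_
  simp

variable {E : Type*} [NormedAddCommGroup E] [NormedSpace ℝ E]
  {H : Type*} [TopologicalSpace H] {I : ModelWithCorners ℝ E H}
  {M : Type*} [TopologicalSpace M] [ChartedSpace H M]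
  {F : Type*} [NormedAddCommGroup F] [NormedSpace ℝ F]
  {G : Type*} [NormedAddCommGroup G] [NormedSpace ℝ G]

theorem mvfderiv_comp_hasFDerivAt {f : M → F} {x : M} {φ : F → G} {φ' : F →L[ℝ] G}
    (hφ : HasFDerivAt φ φ' (f x)) (hf : MDifferentiableAt I 𝓘(ℝ, F) f x) (v : TangentSpace I x) :
    mvfderiv I (fun y ↦ φ (f y)) x v = φ' (mvfderiv I f x v) := by
  have h := mfderiv_comp (I' := 𝓘(ℝ, F)) (I'' := 𝓘(ℝ, G)) x
    hφ.differentiableAt.mdifferentiableAt hf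
  rw [mfderiv_eq_fderiv, hφ.fderiv] at h
  exact congr($h v)

theorem contMDiffAt_matrix {m : ℕ} {A : M → Fin m → Fin m → ℝ} {x : M}
    (hA : ∀ i j, ContMDiffAt I 𝓘(ℝ) ∞ (fun y ↦ A y i j) x) :
    ContMDiffAt I 𝓘(ℝ, Fin m → Fin m → ℝ) ∞ A x :=
  contMDiffAt_pi_space.2 fun i ↦ contMDiffAt_pi_space.2 (hA i)

theorem mvfderiv_det {m : ℕ} {A : M → Fin m → Fin m → ℝ} {x : M}
    (hA : MDifferentiableAt I 𝓘(ℝ, Fin m → Fin m → ℝ) A x) (v : TangentSpace I x) :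
    mvfderiv I (fun y ↦ (Matrix.of (A y)).det) x v =
      (detMap m).linearDeriv (A x) fun i j ↦ mvfderiv I (fun y ↦ A y i j) x v := by
  have h := mvfderiv_comp_hasFDerivAt ((detMap m).hasFDerivAt (x := A x)) hA v
  refine h.trans (congrArg _ ?_)
  ext i j
  exact (mvfderiv_clm_comp ((ContinuousLinearMap.proj (R := ℝ) (φ := fun _ : Fin m ↦ ℝ) j).comp
    (ContinuousLinearMap.proj (R := ℝ) (φ := fun _ : Fin m ↦ Fin m → ℝ) i)) hA v).symm

end Det

variable {n : ℕ} {U : Opens (Sph n)}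

theorem isPosDef_roundMetric (x : U) : IsPosDef (bilinAt (roundMetric U) x) := by
  refine ⟨fun X Y ↦ real_inner_comm (dincl x Y) (dincl x X), fun X hX ↦ ?_⟩
  refine (real_inner_self_pos (x := dincl x X)).2 fun h ↦ hX ?_
  exact dincl_injective x (h.trans (map_zero _).symm)

theorem volElement_eq_sqrt (g : Tensor2 U) (x : U) (v : Fin n → TangentSpace (𝓡 n) x) :
    volElement g x v = √(gramDet (bilinAt g x) v) := rfl

theorem contMDiff_gramDet {g : Tensor2 U} (hg : SmoothTensor g) (w : Fin n → (EuclideanSpace ℝ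
    (Fin (n + 1)))) :
    ContMDiff (𝓡 n) 𝓘(ℝ) ∞ fun x : U ↦ gramDet (bilinAt g x) fun i ↦ tfield U (w i) x := fun x ↦
  (detMap n).contDiff.contMDiff.contMDiffAt.comp x
    (contMDiffAt_matrix fun _ _ ↦ ((hg x).clm_apply contMDiffAt_const).clm_apply contMDiffAt_const)

theorem mvfderiv_gramDet {g : Tensor2 U} (hg : SmoothTensor g) (p : U)
    (e : Fin n → TangentSpace (𝓡 n) p) (Z : TangentSpace (𝓡 n) p) :
    mvfderiv (𝓡 n) (fun x : U ↦ gramDet (bilinAt g x) fun i ↦ tfield U (dincl p (e i)) x) p Z =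
      (detMap n).linearDeriv (fun i j ↦ g p (e i) (e j))
        fun i j ↦ covTensor g p Z (e i) (e j) := by
  have h := mvfderiv_det (I := 𝓡 n) (m := n) (x := p)
    (A := fun x i j ↦ ext2 g x (dincl p (e i)) (dincl p (e j)))
    ((contMDiffAt_matrix fun i j ↦ ((hg p).clm_apply contMDiffAt_const).clm_apply
      contMDiffAt_const).mdifferentiableAt (by simp)) Z
  simp only [ext2_dincl] at h
  refine h.trans (congrArg _ ?_)
  ext i j
  rw [covTensor_apply, mvfderiv_ext2_apply hg]

/-- Pointwise, the ratio of Gram determinants does not depend on the vectors. Near `p` it is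
computed on smooth fields extending an orthonormal basis at `p`, which shows that it is smooth. -/
theorem exists_density (g : PosTensor U) : ∃ ρ : U → ℝ, (∀ x, 0 < ρ x) ∧
    ContMDiff (𝓡 n) 𝓘(ℝ) ∞ ρ ∧ ∀ (x : U) (v : Fin n → TangentSpace (𝓡 n) x),
      gramDet (bilinAt g.inner x) v = ρ x * gramDet (bilinAt (roundMetric U) x) v := by
  choose ρ hρ0 hρ using fun x ↦ (isPosDef_bilinAt g x).exists_gramDet_eq_mul
    (isPosDef_roundMetric x) (finrank_tangentSpace x)
  refine ⟨ρ, hρ0, fun p ↦ ?_, hρ⟩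
  obtain ⟨e, he⟩ := (isPosDef_roundMetric p).exists_orthonormal (finrank_tangentSpace p)
  have h1 := contMDiff_gramDet (smoothTensor_inner g) (fun i ↦ dincl p (e i)) p
  have h2 := contMDiff_gramDet (smoothTensor_roundMetric (U := U)) (fun i ↦ dincl p (e i)) p
  have h3 : gramDet (bilinAt (roundMetric U) p) (fun i ↦ tfield U (dincl p (e i)) p) ≠ 0 := by
    simp only [tfield_dincl]
    rw [he.gramDet_eq_one]
    exact one_ne_zero
  refine (h1.div₀ h2 h3).congr_of_eventuallyEq ?_
  filter_upwards [h2.continuousAt.eventually_ne h3] with x hx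
  exact (eq_div_of_mul_eq hx (hρ x _).symm)

theorem IsVolumeFactor.gramDet_eq {r : ℝ} {g : PosTensor U} {F : U → ℝ}
    (hF : IsVolumeFactor r g.inner F) (x : U) (v : Fin n → TangentSpace (𝓡 n) x) :
    gramDet (bilinAt g.inner x) v = F x ^ (2 * r) * gramDet (bilinAt (roundMetric U) x) v := by
  have h := congrArg (· ^ 2) (hF.2.2 x v)
  simp only [volElement_eq_sqrt, mul_pow] at h
  rw [Real.sq_sqrt ((isPosDef_bilinAt g x).gramDet_nonneg (finrank_tangentSpace x) v),
    Real.sq_sqrt ((isPosDef_roundMetric x).gramDet_nonneg (finrank_tangentSpace x) v)] at h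
  rw [h, mul_comm 2 r, Real.rpow_mul (hF.1 x).le, Real.rpow_two]

theorem isVolumeFactor_iff {r : ℝ} {g : PosTensor U} {F : U → ℝ} (h0 : ∀ x, 0 < F x)
    (hs : ContMDiff (𝓡 n) 𝓘(ℝ) ∞ F) : IsVolumeFactor r g.inner F ↔
      ∀ (x : U) (v : Fin n → TangentSpace (𝓡 n) x), gramDet (bilinAt g.inner x) v =
        F x ^ (2 * r) * gramDet (bilinAt (roundMetric U) x) v := by
  refine ⟨fun h ↦ h.gramDet_eq, fun h ↦ ⟨h0, hs, fun x v ↦ ?_⟩⟩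
  rw [volElement_eq_sqrt, volElement_eq_sqrt, h, mul_comm 2 r, Real.rpow_mul (h0 x).le,
    Real.rpow_two, Real.sqrt_mul (sq_nonneg _), Real.sqrt_sq (Real.rpow_nonneg (h0 x).le _)]

theorem existsUnique_isVolumeFactor {r : ℝ} (hr : r ≠ 0) (g : PosTensor U) :
    ∃! F : U → ℝ, IsVolumeFactor r g.inner F := by
  obtain ⟨ρ, hρ0, hρs, hρ⟩ := exists_density g
  have hF0 (x : U) : 0 < ρ x ^ (1 / (2 * r)) := Real.rpow_pos_of_pos (hρ0 x) _
  refine ⟨fun x ↦ ρ x ^ (1 / (2 * r)), (isVolumeFactor_iff hF0 fun x ↦ ?_).2 fun x v ↦ ?_,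
    fun F hF ↦ funext fun x ↦ ?_⟩
  · exact (Real.contDiffAt_rpow_const_of_ne (hρ0 x).ne').contMDiffAt.comp x (hρs x)
  · rw [hρ, ← Real.rpow_mul (hρ0 x).le, one_div_mul_cancel (by simpa using hr), Real.rpow_one]
  · obtain ⟨e, he⟩ := (isPosDef_roundMetric x).exists_orthonormal (finrank_tangentSpace x)
    have h1 := hF.gramDet_eq x e
    rw [hρ, he.gramDet_eq_one, mul_one, mul_one] at h1
    rw [h1, ← Real.rpow_mul (hF.1 x).le, mul_one_div_cancel (by simpa using hr), Real.rpow_one]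

/-- Differentiate `gramDet g = F ^ (2r) * gramDet roundMetric` on the extensions of `e`. The left
side gives the trace by Jacobi's formula, since `e` is `g`-orthonormal at `p`; the round Gram
determinant is stationary at `p`, since the round metric is parallel. -/
theorem IsVolumeFactor.sum_covTensor {r : ℝ} {g : PosTensor U} {F : U → ℝ}
    (hF : IsVolumeFactor r g.inner F) {p : U} {e : Fin n → TangentSpace (𝓡 n) p}
    (he : IsOrthonormal (bilinAt g.inner p) e) (Z : TangentSpace (𝓡 n) p) :
    ∑ i, covTensor g.inner p Z (e i) (e i) = 2 * r * (mvfderiv (𝓡 n) F p Z / F p) := by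
  have h1 := mvfderiv_gramDet (smoothTensor_inner g) p e Z
  have he' : (fun i j ↦ g.inner p (e i) (e j)) = fun i j ↦ if i = j then 1 else 0 := by
    ext i j; exact he i j
  rw [he', linearDeriv_detMap_one] at h1
  have h2 := mvfderiv_gramDet (smoothTensor_roundMetric (U := U)) p e Z
  rw [covTensor_roundMetric] at h2
  have h2' : mvfderiv (𝓡 n) (fun x : U ↦ gramDet (bilinAt (roundMetric U) x)
      fun i ↦ tfield U (dincl p (e i)) x) p Z = 0 := h2.trans (map_zero _)
  have hp : 0 < F p := hF.1 p
  have h3 : HasFDerivAt (fun t : ℝ ↦ t ^ (2 * r)) _ (F p) :=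
    (Real.hasDerivAt_rpow_const (p := 2 * r) (Or.inl hp.ne')).hasFDerivAt
  have hFd : MDifferentiableAt (𝓡 n) 𝓘(ℝ) F p := hF.2.1.mdifferentiable (by simp) p
  have h4 := mvfderiv_comp_hasFDerivAt h3 hFd Z
  have h5 : MDifferentiableAt (𝓡 n) 𝓘(ℝ) (fun x ↦ F x ^ (2 * r)) p :=
    h3.differentiableAt.mdifferentiableAt.comp p hFd
  have h6 := (contMDiff_gramDet (smoothTensor_roundMetric (U := U))
    fun i ↦ dincl p (e i)).mdifferentiable (by simp) p
  have h7 := mvfderiv_fun_mul h5 h6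
  simp only [← hF.gramDet_eq] at h7
  have h8 := congr($h7 Z)
  have h9 := hF.gramDet_eq p e
  rw [he.gramDet_eq_one] at h9
  have h10 := h8.trans (congrArg₂ (fun a b ↦ F p ^ (2 * r) * a +
    gramDet (bilinAt (roundMetric U) p) (fun i ↦ tfield U (dincl p (e i)) p) * b) h2' h4)
  simp only [tfield_dincl] at h10
  rw [← h1]
  refine h10.trans ?_
  simp only [mul_zero, zero_add, ContinuousLinearMap.toSpanSingleton_apply, smul_eq_mul,
    Real.rpow_sub_one hp.ne']
  linear_combination -(2 * r * (mvfderiv (𝓡 n) F p Z / F p)) * h9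

end

/-! ### Rescaling by volume factors, and the two directions of the correspondence -/

section

variable {n : ℕ} {U : Opens (Sph n)}

theorem PosTensor.ext {g k : PosTensor U} (h : ∀ x, g.inner x = k.inner x) : g = k := by
  cases g; cases k
  congr
  exact funext h

set_option synthInstance.maxHeartbeats 200000 in
/-- The product of a Riemannian metric with a positive smooth function. -/
def PosTensor.scale (g : PosTensor U) (f : U → ℝ) (h0 : ∀ x, 0 < f x)
    (hf : ContMDiff (𝓡 n) 𝓘(ℝ) ∞ f) : PosTensor U where
  inner x := f x • g.inner x
  symm x v w := congrArg (f x * ·) (g.symm x v w)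
  pos x v hv := mul_pos (h0 x) (g.pos x v hv)
  isVonNBounded x := by
    -- The unit ball of `f g` is the unit ball of `g` scaled by `1 / √f`.
    refine ((g.isVonNBounded x).image ((√(f x))⁻¹ •
      ContinuousLinearMap.id ℝ (TangentSpace (𝓡 n) x))).subset fun v hv ↦ ?_
    have h1 : √(f x) ≠ 0 := (Real.sqrt_pos.2 (h0 x)).ne'
    refine ⟨√(f x) • v, ?_, ?_⟩
    · have h2 : f x * g.inner x v v < 1 := hv
      have h3 : g.inner x (√(f x) • v) (√(f x) • v) = f x * g.inner x v v := by
        conv_rhs => rw [← Real.mul_self_sqrt (h0 x).le]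
        rw [(g.inner x).map_smul, _root_.smul_apply, (g.inner x v).map_smul, smul_eq_mul,
          smul_eq_mul, mul_assoc]
      exact h3.trans_lt h2
    · exact inv_smul_smul₀ h1 v
  contMDiff := hf.smul_section g.contMDiff

theorem gramDet_smul {V : Type*} [AddCommGroup V] [Module ℝ V] (c : ℝ) (b : V →ₗ[ℝ] V →ₗ[ℝ] ℝ)
    (v : Fin n → V) : gramDet (c • b) v = c ^ n * gramDet b v := by
  have h : (Matrix.of fun i j ↦ (c • b) (v i) (v j)) = c • Matrix.of fun i j ↦ b (v i) (v j) := rfl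
  rw [gramDet, h, Matrix.det_smul, Fintype.card_fin, gramDet]

theorem contMDiff_one_div {f : U → ℝ} (h0 : ∀ x, 0 < f x) (hf : ContMDiff (𝓡 n) 𝓘(ℝ) ∞ f) :
    ContMDiff (𝓡 n) 𝓘(ℝ) ∞ fun x ↦ 1 / f x :=
  contMDiff_const.div₀ hf fun x ↦ (h0 x).ne'

/-- The metric `g / F`, where `F` is a volume factor of `g`. -/
def IsVolumeFactor.quotient {r : ℝ} {g : PosTensor U} {F : U → ℝ}
    (hF : IsVolumeFactor r g.inner F) : PosTensor U :=
  g.scale (fun x ↦ 1 / F x) (fun x ↦ one_div_pos.2 (hF.1 x)) (contMDiff_one_div hF.1 hF.2.1)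

theorem IsVolumeFactor.quotient_inner {r : ℝ} {g : PosTensor U} {F : U → ℝ}
    (hF : IsVolumeFactor r g.inner F) (x : U) : hF.quotient.inner x = (1 / F x) • g.inner x := rfl

theorem IsVolumeFactor.eq_smul {r : ℝ} {g : PosTensor U} {F : U → ℝ}
    (hF : IsVolumeFactor r g.inner F) (x : U) : g.inner x = F x • hF.quotient.inner x := by
  rw [hF.quotient_inner, smul_smul, mul_one_div_cancel (hF.1 x).ne', one_smul]

/-- Scaling by `1 / F` multiplies the Gram determinant by `F ^ (-n)`, so it becomes `F ^ (2r - n) =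
(1 / F) ^ (2s)` times the round one. -/
theorem IsVolumeFactor.isVolumeFactor_quotient {r s : ℝ} {g : PosTensor U} {F : U → ℝ}
    (hF : IsVolumeFactor r g.inner F) (hs : 2 * s = n - 2 * r) :
    IsVolumeFactor s hF.quotient.inner fun x ↦ 1 / F x := by
  refine (isVolumeFactor_iff (fun x ↦ one_div_pos.2 (hF.1 x))
    (contMDiff_one_div hF.1 hF.2.1)).2 fun x v ↦ ?_
  have h1 : bilinAt hF.quotient.inner x = (1 / F x) • bilinAt g.inner x := rfl
  rw [h1, gramDet_smul, hF.gramDet_eq, ← mul_assoc, hs, one_div, Real.inv_rpow (hF.1 x).le,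
    ← Real.rpow_neg (hF.1 x).le, neg_sub, Real.rpow_sub (hF.1 x), Real.rpow_natCast, inv_pow]
  ring

theorem covTensor_of_eq_smul {g k : PosTensor U} {f : U → ℝ} (hf : ContMDiff (𝓡 n) 𝓘(ℝ) ∞ f)
    (h : ∀ x, g.inner x = f x • k.inner x) (x : U) (Z X Y : TangentSpace (𝓡 n) x) :
    covTensor g.inner x Z X Y =
      f x * covTensor k.inner x Z X Y + mvfderiv (𝓡 n) f x Z * k.inner x X Y := by
  have hk := smoothTensor_inner k
  rw [covTensor_apply, covTensor_apply, mvfderiv_ext2_apply (smoothTensor_inner g),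
    mvfderiv_ext2_apply hk]
  have e : (fun y ↦ ext2 g.inner y (dincl x X) (dincl x Y)) =
      fun y ↦ f y * ext2 k.inner y (dincl x X) (dincl x Y) := by
    ext y
    rw [ext2_apply, h]
    rfl
  have h2 : MDifferentiableAt (𝓡 n) 𝓘(ℝ) (fun y ↦ ext2 k.inner y (dincl x X) (dincl x Y)) x :=
    ((hk.mdifferentiableAt x).clm_apply mdifferentiableAt_const).clm_apply mdifferentiableAt_const
  rw [e, mvfderiv_fun_mul (hf.mdifferentiable (by simp) x) h2, ext2_dincl]
  simp only [_root_.add_apply, _root_.smul_apply, smul_eq_mul]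
  ring

/-- Polarisation reduces the cyclic sum to the diagonal. The connection in the definition is an
arbitrary Levi-Civita connection of the round metric; by the Koszul formula with `∇̄ḡ = 0` it agrees
with `roundCov` where needed. -/
theorem isKillingTensor_iff (k : PosTensor U) : IsKillingTensor (roundMetric U) k.inner ↔
    ∀ (x : U) (X : TangentSpace (𝓡 n) x), covTensor k.inner x X X X = 0 := by
  have hk := smoothTensor_inner k
  constructor
  · rintro ⟨cov, hcov, H⟩ x v
    set X : VField U := tfield U (dincl x v)
    have hX : DiffAt X x := (smoothAt_tfield _ x).diffAt
    have hXx : X x = v := tfield_dincl x v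
    have h1 : cov X x (X x) = roundCov U X x (X x) := by
      by_contra h
      refine ((isPosDef_roundMetric x).pos _ (sub_ne_zero.2 h)).ne' ?_
      have h2 := hcov.koszul smoothTensor_roundMetric (fun x ↦ (isPosDef_roundMetric x).symm) hX hX
        (cov X x (X x) - roundCov U X x (X x))
      rw [covTensor_roundMetric] at h2
      rw [bilinAt_apply]
      simpa using h2
    have h3 := H x X X X hX hX hX
    have h4 := covDerivTensor_roundCov hk X hX hX
    rw [covDerivTensor, ← h1, ← covDerivTensor, hXx] at h4
    linarith
  · intro H
    refine ⟨roundCov U, isLeviCivita_roundCov, fun x X Y Z hX hY hZ ↦ ?_⟩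
    rw [covDerivTensor_roundCov hk Z hX hY, covDerivTensor_roundCov hk X hY hZ,
      covDerivTensor_roundCov hk Y hZ hX]
    have h := cyclic_sum_eq_of_diag (θ := 0) (isPosDef_bilinAt k x)
      (covTensor_symm hk k.symm x) (by simpa using H x) (Z x) (X x) (Y x)
    simpa using h

theorem IsVolumeFactor.isKillingTensor_quotient (hn : 2 ≤ n) {g : PosTensor U}
    (hg : HasMinimalEquators g.inner) {F : U → ℝ} (hF : IsVolumeFactor ((n + 1) / 4) g.inner F) :
    IsKillingTensor (roundMetric U) hF.quotient.inner := by
  obtain ⟨m, rfl⟩ : ∃ m, n = m + 1 := ⟨n - 1, by omega⟩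
  refine (isKillingTensor_iff _).2 fun x X ↦ ?_
  have hb := isPosDef_bilinAt g x
  obtain ⟨f, hf⟩ := hb.exists_orthonormal (finrank_tangentSpace x)
  have h1 := diag_eq_of_sum_curvForm_eq_zero hb
    (covTensor_symm (smoothTensor_inner g) g.symm x) (finrank_tangentSpace x)
    ((hasMinimalEquators_iff g).1 hg x) hf X
  rw [hF.sum_covTensor hf, covTensor_of_eq_smul hF.2.1 hF.eq_smul, bilinAt_apply, hF.eq_smul] at h1
  have h2 : F x ≠ 0 := (hF.1 x).ne'
  have h3 : (m : ℝ) + 2 ≠ 0 := by positivity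
  rw [_root_.smul_apply, _root_.smul_apply, smul_eq_mul] at h1
  -- With `n = m + 1` the constants `2 / (m + 2)` and `2 (n + 1) / 4` cancel. This is where the
  -- exponent `(n + 1) / 4` is used: it makes `θ` equal to `dF / F`.
  have h5 : 2 / ((m : ℝ) + 2) * (2 * (((m + 1 : ℕ) + 1) / 4) *
      (mvfderiv (𝓡 (m + 1)) F x X / F x)) * (F x * hF.quotient.inner x X X) =
      mvfderiv (𝓡 (m + 1)) F x X * hF.quotient.inner x X X := by
    push_cast
    field_simp
    ring
  have h4 := add_eq_right.1 (h1.trans h5)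
  exact (mul_eq_zero.1 h4).resolve_left h2

theorem IsVolumeFactor.hasMinimalEquators_quotient (hn : 2 ≤ n) {k : PosTensor U}
    (hk : IsKillingTensor (roundMetric U) k.inner) {D : U → ℝ}
    (hD : IsVolumeFactor ((n - 1) / 4) k.inner D) : HasMinimalEquators hD.quotient.inner := by
  obtain ⟨m, rfl⟩ : ∃ m, n = m + 1 := ⟨n - 1, by omega⟩
  have hφ := hD.isVolumeFactor_quotient (s := ((m + 1 : ℕ) + 1) / 4) (by push_cast; ring)
  refine (hasMinimalEquators_iff _).2 fun x X e hX he hXe ↦ ?_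
  have hb := isPosDef_bilinAt hD.quotient x
  obtain ⟨f, hf⟩ := hb.exists_orthonormal (finrank_tangentSpace x)
  -- The volume factor of `k / D` is `1 / D`, so the form `d log F` is here `D d(1 / D)`.
  obtain ⟨θ, hθ⟩ : ∃ θ : TangentSpace (𝓡 (m + 1)) x →ₗ[ℝ] ℝ, ∀ Y,
      θ Y = D x * mvfderiv (𝓡 (m + 1)) (fun x ↦ 1 / D x) x Y :=
    ⟨(D x • mvfderiv (𝓡 (m + 1)) (fun x ↦ 1 / D x) x).toLinearMap, fun _ ↦ rfl⟩
  refine sum_curvForm_eq_zero (θ := θ) hb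
    (covTensor_symm (smoothTensor_inner hD.quotient) hD.quotient.symm x)
    (finrank_tangentSpace x) hf (fun Y ↦ ?_) (fun Y ↦ ?_) he hXe
  · rw [covTensor_of_eq_smul hφ.2.1 hD.quotient_inner, (isKillingTensor_iff k).1 hk, hθ,
      bilinAt_apply, hD.eq_smul]
    have h3 : (D x • hD.quotient.inner x) Y Y = D x * hD.quotient.inner x Y Y := rfl
    rw [h3, mul_zero, zero_add]
    ring
  · rw [hφ.sum_covTensor hf, hθ, div_div_eq_mul_div, div_one]
    push_cast
    ring

end

end MinimalEquators

end

theorem mainTheorem2 (n : ℕ) (hn : 2 ≤ n)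
    (U : TopologicalSpace.Opens (MinimalEquators.Sph n)) :
    -- the functions `F_g` and `D_k` exist and are unique
    (∀ g : MinimalEquators.PosTensor U,
      ∃! F : U → ℝ, MinimalEquators.IsVolumeFactor (((n : ℝ) + 1) / 4) g.inner F) ∧
    (∀ k : MinimalEquators.PosTensor U,
      ∃! D : U → ℝ, MinimalEquators.IsVolumeFactor (((n : ℝ) - 1) / 4) k.inner D) ∧
    -- the maps `g ↦ g / F_g` and `k ↦ k / D_k` are well defined and mutually inverse
    ∃ (Φ : MinimalEquators.MinimalEquatorMetric U → MinimalEquators.PosKillingTensor U)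
      (Ψ : MinimalEquators.PosKillingTensor U → MinimalEquators.MinimalEquatorMetric U),
      (∀ (g : MinimalEquators.MinimalEquatorMetric U) (F : U → ℝ),
        MinimalEquators.IsVolumeFactor (((n : ℝ) + 1) / 4) g.1.inner F →
          ∀ x, (Φ g).1.inner x = (1 / F x) • g.1.inner x) ∧
      (∀ (k : MinimalEquators.PosKillingTensor U) (D : U → ℝ),
        MinimalEquators.IsVolumeFactor (((n : ℝ) - 1) / 4) k.1.inner D →
          ∀ x, (Ψ k).1.inner x = (1 / D x) • k.1.inner x) ∧
      Function.LeftInverse Ψ Φ ∧ Function.RightInverse Ψ Φ := by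
  have hn' : (2 : ℝ) ≤ n := by exact_mod_cast hn
  have hF (g : MinimalEquators.PosTensor U) := MinimalEquators.existsUnique_isVolumeFactor
    (r := ((n : ℝ) + 1) / 4) (by positivity) g
  have hD (k : MinimalEquators.PosTensor U) := MinimalEquators.existsUnique_isVolumeFactor
    (r := ((n : ℝ) - 1) / 4) (by linarith) k
  refine ⟨hF, hD, ?_⟩
  choose F hF' hFu using hF
  choose D hD' hDu using hD
  let Φ : MinimalEquators.MinimalEquatorMetric U → MinimalEquators.PosKillingTensor U :=
    fun g ↦ ⟨(hF' g.1).quotient, (hF' g.1).isKillingTensor_quotient hn g.2⟩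
  let Ψ : MinimalEquators.PosKillingTensor U → MinimalEquators.MinimalEquatorMetric U :=
    fun k ↦ ⟨(hD' k.1).quotient, (hD' k.1).hasMinimalEquators_quotient hn k.2⟩
  have hΦ (g : MinimalEquators.MinimalEquatorMetric U) (f : U → ℝ)
      (hf : MinimalEquators.IsVolumeFactor (((n : ℝ) + 1) / 4) g.1.inner f) (x : U) :
      (Φ g).1.inner x = (1 / f x) • g.1.inner x := by
    rw [hFu g.1 f hf]; rfl
  have hΨ (k : MinimalEquators.PosKillingTensor U) (f : U → ℝ)
      (hf : MinimalEquators.IsVolumeFactor (((n : ℝ) - 1) / 4) k.1.inner f) (x : U) :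
      (Ψ k).1.inner x = (1 / f x) • k.1.inner x := by
    rw [hDu k.1 f hf]; rfl
  refine ⟨Φ, Ψ, hΦ, hΨ, fun g ↦ Subtype.ext (MinimalEquators.PosTensor.ext fun x ↦ ?_),
    fun k ↦ Subtype.ext (MinimalEquators.PosTensor.ext fun x ↦ ?_)⟩
  -- The volume factor of `g / F` with exponent `(n - 1) / 4` is `1 / F`, so the second map
  -- multiplies by `F` again.
  · rw [hΨ (Φ g) _ ((hF' g.1).isVolumeFactor_quotient (by ring)), (hF' g.1).eq_smul, one_div_one_div]
  · rw [hΦ (Ψ k) _ ((hD' k.1).isVolumeFactor_quotient (by ring)), (hD' k.1).eq_smul, one_div_one_div]
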